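/- Let $k$ be a field of characteristic $p>0$, let $n\ge 0$ be an integer, and let $$R=k[T,\;xT,\;xyT,\;yT,\;x^{-1}yT,\;x^{-2}yT,\;\ldots,\;x^{-n}yT]\subseteq k[x^{\pm1},y^{\pm1},T^{\pm1}]$$ be the rational normal scroll, where $x,y,T$ are indeterminates. Let $\mathfrak m=(T,xT,xyT,yT,x^{-1}yT,\ldots,x^{-n}yT)\subset R$ be the (maximal) irrelevant ideal and $A=R_{\mathfrak m}$. Then $A$ is a three-dimensional Cohen--Macaulay F-rational local domain (every parameter ideal of $A$, and of each localization of $A$ at a prime ideal, is tightly closed) whose Hilbert--Samuel multiplicity is $e(A)=n+2$, and whose Hilbert--Kunz multiplicity is $$e_{\rm HK}(A)=\frac{e(A)}{2}+\frac{e(A)}{6(n+1)}.$$ Here, with $d=\dim A=3$, $\mathfrak n=\mathfrak mA$ the maximal ideal of $A$, and $\ell_A$ denoting length, $$e(A)=\lim_{N\to\infty}\frac{d!}{N^d}\,\ell_A(A/\mathfrak n^{N}),\qquad e_{\rm HK}(A)=\lim_{r\to\infty}\frac{\ell_A(A/\mathfrak n^{[p^r]})}{p^{rd}},\qquad \mathfrak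 n^{[q]}=(a^q\mid a\in\mathfrak n),$$ and these limits exist. -/

import Mathlib

open Filter Topology

/-- The Laurent polynomial ring `k[x, x⁻¹, y, y⁻¹, T, T⁻¹]`, as the group algebra of `ℤ³`. -/
abbrev LaurentRing (k : Type*) [Field k] : Type _ := AddMonoidAlgebra k (ℤ × ℤ × ℤ)

/-- The monomial `x ^ a * y ^ b * T ^ c`. -/
noncomputable def laurentMonomial (k : Type*) [Field k] (a b c : ℤ) : LaurentRing k :=
  AddMonoidAlgebra.single (a, b, c) 1

/-- The monomials `T, xT, xyT, yT, x⁻¹yT, …, x⁻ⁿyT`. -/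
def scrollGenerators (k : Type*) [Field k] (n : ℕ) : Set (LaurentRing k) :=
  {laurentMonomial k 0 0 1, laurentMonomial k 1 0 1, laurentMonomial k 1 1 1,
    laurentMonomial k 0 1 1} ∪
  {f | ∃ i : ℕ, 1 ≤ i ∧ i ≤ n ∧ f = laurentMonomial k (-(i : ℤ)) 1 1}

/-- The ring `R = k[T, xT, xyT, yT, x⁻¹yT, …, x⁻ⁿyT]`. -/
noncomputable def scrollRing (k : Type*) [Field k] (n : ℕ) : Subalgebra k (LaurentRing k) :=
  Algebra.adjoin k (scrollGenerators k n)

/-- The ideal `(T, xT, xyT, yT, x⁻¹yT, …, x⁻ⁿyT)` of `R`. -/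
noncomputable def scrollIdeal (k : Type*) [Field k] (n : ℕ) : Ideal (scrollRing k n) :=
  Ideal.span {f | (f : LaurentRing k) ∈ scrollGenerators k n}

theorem support_mul_bound {k : Type*} [Field k] {f g : LaurentRing k} {a b : ℤ}
    (hf : ∀ u ∈ f.coeff.support, a ≤ u.2.2) (hg : ∀ u ∈ g.coeff.support, b ≤ u.2.2) :
    ∀ u ∈ (f * g).coeff.support, a + b ≤ u.2.2 := by
  classical
  intro u hu
  obtain ⟨v, hv, w, hw, rfl⟩ := Finset.mem_add.1 (AddMonoidAlgebra.support_coeff_mul_subset f g hu)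
  exact add_le_add (hf v hv) (hg w hw)

theorem support_add_bound {k : Type*} [Field k] {f g : LaurentRing k} {a : ℤ}
    (hf : ∀ u ∈ f.coeff.support, a ≤ u.2.2) (hg : ∀ u ∈ g.coeff.support, a ≤ u.2.2) :
    ∀ u ∈ (f + g).coeff.support, a ≤ u.2.2 := by
  classical
  intro u hu
  rw [AddMonoidAlgebra.coeff_add] at hu
  rcases Finset.mem_union.1 (Finsupp.support_add hu) with h | h
  · exact hf u h
  · exact hg u h

theorem support_single_bound (k : Type*) [Field k] (v : ℤ × ℤ × ℤ) (r : k) :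
    ∀ u ∈ (AddMonoidAlgebra.single v r : LaurentRing k).coeff.support, v.2.2 ≤ u.2.2 := by
  classical
  intro u hu
  rw [AddMonoidAlgebra.coeff_single] at hu
  have := Finsupp.support_single_subset hu
  rw [Finset.mem_singleton] at this
  rw [this]

theorem support_scrollGenerators {k : Type*} [Field k] {n : ℕ} {f : LaurentRing k}
    (hf : f ∈ scrollGenerators k n) : ∀ u ∈ f.coeff.support, 1 ≤ u.2.2 := by
  rcases hf with (rfl | rfl | rfl | rfl) | ⟨i, -, -, rfl⟩ <;> exact support_single_bound k _ _

theorem support_scrollRing {k : Type*} [Field k] {n : ℕ} {f : LaurentRing k}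
    (hf : f ∈ scrollRing k n) : ∀ u ∈ f.coeff.support, 0 ≤ u.2.2 := by
  induction hf using Algebra.adjoin_induction with
  | mem f hf => intro u hu; linarith [support_scrollGenerators hf u hu]
  | algebraMap r => exact support_single_bound k (0, 0, 0) r
  | add f g _ _ hf hg => exact support_add_bound hf hg
  | mul f g _ _ hf hg => simpa using support_mul_bound hf hg

theorem support_scrollIdeal {k : Type*} [Field k] {n : ℕ} {f : scrollRing k n}
    (hf : f ∈ scrollIdeal k n) : ∀ u ∈ (f : LaurentRing k).coeff.support, 1 ≤ u.2.2 := by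
  induction hf using Submodule.span_induction with
  | mem f hf => exact support_scrollGenerators hf
  | zero => simp
  | add f g _ _ hf hg => exact support_add_bound hf hg
  | smul a f _ hf => simpa using support_mul_bound (support_scrollRing a.2) hf

theorem scrollIdeal_ne_top (k : Type*) [Field k] (n : ℕ) : scrollIdeal k n ≠ ⊤ := by
  intro h
  have h1 : (1 : scrollRing k n) ∈ scrollIdeal k n := h ▸ Submodule.mem_top
  have := support_scrollIdeal h1 (0, 0, 0) (by
    simp [AddMonoidAlgebra.one_def])
  norm_num at this

theorem exists_sub_mem_scrollIdeal {k : Type*} [Field k] {n : ℕ} {f : LaurentRing k}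
    (hf : f ∈ scrollRing k n) :
    ∃ r : k, (⟨f, hf⟩ : scrollRing k n) - algebraMap k _ r ∈ scrollIdeal k n := by
  induction hf using Algebra.adjoin_induction with
  | mem f hf => exact ⟨0, by rw [map_zero, sub_zero]; exact Ideal.subset_span hf⟩
  | algebraMap r => exact ⟨r, by convert (scrollIdeal k n).zero_mem; exact sub_self _⟩
  | add f g hf' hg' hf hg =>
    obtain ⟨r, hr⟩ := hf
    obtain ⟨s, hs⟩ := hg
    refine ⟨r + s, ?_⟩
    convert (scrollIdeal k n).add_mem hr hs using 1
    rw [map_add]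
    exact add_sub_add_comm (⟨f, hf'⟩ : scrollRing k n) ⟨g, hg'⟩ _ _
  | mul f g hf' hg' hf hg =>
    obtain ⟨r, hr⟩ := hf
    obtain ⟨s, hs⟩ := hg
    refine ⟨r * s, ?_⟩
    convert (scrollIdeal k n).add_mem ((scrollIdeal k n).mul_mem_right ⟨g, hg'⟩ hr)
      ((scrollIdeal k n).mul_mem_left (algebraMap k _ r) hs) using 1
    rw [map_mul, sub_mul, mul_sub, sub_add_sub_cancel]
    rfl

instance scrollIdeal_isMaximal (k : Type*) [Field k] (n : ℕ) : (scrollIdeal k n).IsMaximal := by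
  rw [Ideal.isMaximal_iff]
  refine ⟨(Ideal.ne_top_iff_one _).1 (scrollIdeal_ne_top k n), fun J f hJ hf hfJ => ?_⟩
  obtain ⟨r, hr⟩ := exists_sub_mem_scrollIdeal f.2
  have hr0 : r ≠ 0 := by
    rintro rfl
    rw [map_zero, sub_zero] at hr
    exact hf hr
  have h : algebraMap k (scrollRing k n) r ∈ J := by
    have := J.sub_mem hfJ (hJ hr)
    rwa [sub_sub_cancel] at this
  have := J.mul_mem_left (algebraMap k (scrollRing k n) r⁻¹) h
  rwa [← map_mul, inv_mul_cancel₀ hr0, map_one] at this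

/-- The local ring `A = R_𝔪`. -/
abbrev ScrollLocalRing (k : Type*) [Field k] (n : ℕ) : Type _ :=
  Localization.AtPrime (scrollIdeal k n)

/-- The `q`-th Frobenius power `I^[q] = (a ^ q | a ∈ I)`. -/
def frobeniusPower {A : Type*} [CommRing A] (I : Ideal A) (q : ℕ) : Ideal A :=
  Ideal.span ((fun a => a ^ q) '' (I : Set A))

/-- `e(I) = lim (d! / n ^ d) * length (A / I ^ n)` with `d = dim A`: all the lengths are finite,
and the limit exists and equals `e`. -/
def HasMultiplicity {A : Type*} [CommRing A] (I : Ideal A) (e : ℝ) : Prop :=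
  (∀ n : ℕ, Module.length A (A ⧸ I ^ n) ≠ ⊤) ∧
  ∃ d : ℕ, ringKrullDim A = d ∧
    Tendsto (fun n : ℕ => (d.factorial : ℝ) / (n : ℝ) ^ d *
      ((Module.length A (A ⧸ I ^ n)).toNat : ℝ)) atTop (𝓝 e)

/-- `e_HK(I) = lim length (A / I^[q]) / q ^ d` with `d = dim A`, over `q = p ^ r`, `r → ∞`, in
characteristic `p`: all the lengths are finite, and the limit exists and equals `e`. -/
def HasHilbertKunzMultiplicity {A : Type*} [CommRing A] (p : ℕ) (I : Ideal A) (e : ℝ) : Prop :=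
  (∀ r : ℕ, Module.length A (A ⧸ frobeniusPower I (p ^ r)) ≠ ⊤) ∧
  ∃ d : ℕ, ringKrullDim A = d ∧
    Tendsto (fun r : ℕ => ((Module.length A (A ⧸ frobeniusPower I (p ^ r))).toNat : ℝ) /
      ((p : ℝ) ^ r) ^ d) atTop (𝓝 e)

/-- The depth of a Noetherian local ring: the supremum of the lengths of the regular sequences
in its maximal ideal. -/
noncomputable def localDepth (A : Type*) [CommRing A] [IsLocalRing A] : ℕ∞ :=
  ⨆ (rs : List A) (_ : (∀ r ∈ rs, r ∈ IsLocalRing.maximalIdeal A) ∧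
    RingTheory.Sequence.IsRegular A rs), (rs.length : ℕ∞)

/-- A local ring is Cohen--Macaulay if it is Noetherian and its depth is its dimension. -/
def IsCohenMacaulayLocal (A : Type*) [CommRing A] [IsLocalRing A] : Prop :=
  IsNoetherianRing A ∧ ((localDepth A : ℕ∞) : WithBot ℕ∞) = ringKrullDim A

/-- The tight closure `I*` of an ideal in characteristic `p`: the `x` for which some `c` outside
all minimal primes has `c * x ^ q ∈ I^[q]` for all large `q = p ^ r`. -/
def tightClosure {A : Type*} [CommRing A] (p : ℕ) (I : Ideal A) : Set A :=
  {x | ∃ c : A, (∀ P ∈ minimalPrimes A, c ∉ P) ∧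
    ∃ N : ℕ, ∀ r : ℕ, N ≤ r → c * x ^ (p ^ r) ∈ frobeniusPower I (p ^ r)}

/-- `I* = I`. -/
def IsTightlyClosed {A : Type*} [CommRing A] (p : ℕ) (I : Ideal A) : Prop :=
  tightClosure p I = (I : Set A)

/-- A parameter ideal of a local ring: generated by a system of parameters, that is, an ideal
primary to the maximal ideal that is generated by `dim A` elements. -/
def IsParameterIdeal {A : Type*} [CommRing A] [IsLocalRing A] (J : Ideal A) : Prop :=
  ∃ d : ℕ, ringKrullDim A = d ∧ ∃ s : Fin d → A,
    J = Ideal.span (Set.range s) ∧ J.radical = IsLocalRing.maximalIdeal A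

/-- Every parameter ideal of the local ring `A` is tightly closed. -/
def IsFRationalLocal (p : ℕ) (A : Type*) [CommRing A] [IsLocalRing A] : Prop :=
  ∀ J : Ideal A, IsParameterIdeal J → IsTightlyClosed p J

/-- Every local ring of `A` at a prime ideal has tightly closed parameter ideals. -/
def IsFRational (p : ℕ) (A : Type*) [CommRing A] : Prop :=
  ∀ (P : Ideal A) [P.IsPrime], IsFRationalLocal p (Localization.AtPrime P)

/-! The ring is the semigroup ring of the lattice points of a cone (`mem_scrollRing_iff`). In the
coordinates u = b, v = c - b, i = a + n b, j = c - a of an exponent (a, b, c), the cone consists of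
the nonnegative quadruples with i + j = (n + 1) u + v, and everything reduces to exponents.

Tight closure: given c ≠ 0, fix an exponent m of c. For large q, keeping only the exponents m + q v
and sending them to v gives a map φ that preserves R, satisfies φ (a x^q) = φ a · x, and can be
normalized so that φ c = 1 (`scrollRing_exists_trace`). Applied to c x^q ∈ J^[q], it gives x ∈ J.
Hence every ideal of every localization is tightly closed.

Cohen--Macaulayness: T, xyT, xT - x⁻ⁿyT is a regular sequence whose ideal contains 𝔪²
(`scrollParameters_isWeaklyRegular`, `scrollIdeal_sq_le`), so depth and dimension are both 3.

Multiplicities: lengths modulo monomial ideals count the missing exponents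
(`length_quotient_map_of_isLocalization`). Those of degree below N number about (n + 2) N³ / 6.
Outside 𝔪^[q] there are three regions (`mem_frobenius_complement`). The box u, v < q has about (n +
2) q³ / 2 points. The region v ≥ q is one copy of a corner with about q³ / (6 (n + 1)) points, and
the region u ≥ q is n + 1 further copies, indexed by ⌊i / q⌋. -/

/-! ### Lengths, localization and tight closure in general rings. -/

/-- Over a local `k`-algebra with residue field `k`, the length of a module of finite length is
its length over `k`. -/
theorem IsFiniteLength.length_eq_length_residueField {k A M : Type*} [Field k] [CommRing A]
    [IsLocalRing A] [Algebra k A]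
    (hA : ∀ a : A, ∃ r : k, a - algebraMap k A r ∈ IsLocalRing.maximalIdeal A)
    [AddCommGroup M] [Module A M] (h : IsFiniteLength A M) :
    ∀ [Module k M] [IsScalarTower k A M], Module.length A M = Module.length k M := by
  induction h with
  | of_subsingleton => intros; rw [Module.length_eq_zero, Module.length_eq_zero]
  | @of_simple_quotient M _ _ N hs _ ih =>
    intros
    rw [Module.length_eq_add_of_exact N.subtype N.mkQ N.subtype_injective N.mkQ_surjective
        (LinearMap.exact_subtype_mkQ N), ih,
      Module.length_eq_add_of_exact (N.subtype.restrictScalars k) (N.mkQ.restrictScalars k)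
        N.subtype_injective N.mkQ_surjective (LinearMap.exact_subtype_mkQ N),
      Module.length_eq_one_iff.2 hs]
    congr 1
    symm
    rw [Module.length_eq_one_iff, isSimpleModule_iff_toSpanSingleton_surjective]
    refine ⟨hs.nontrivial, fun x hx y => ?_⟩
    obtain ⟨a, rfl⟩ := (isSimpleModule_iff_toSpanSingleton_surjective.1 hs).2 x hx y
    obtain ⟨r, hr⟩ := hA a
    refine ⟨r, ?_⟩
    -- The maximal ideal kills the simple quotient, so `a` acts on it as the scalar `r`.
    rw [← IsLocalRing.eq_maximalIdeal (IsSimpleModule.annihilator_isMaximal (M := M ⧸ N)),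
      Module.mem_annihilator] at hr
    have := hr x
    rw [sub_smul, algebraMap_smul, sub_eq_zero] at this
    simpa using this.symm

/-- If `I` contains a power of the maximal ideal `m`, then `R ⧸ I` is already local. -/
theorem bijective_quotientMap_localization_atPrime {R : Type*} [CommRing R] (m : Ideal R)
    [m.IsMaximal] (A : Type*) [CommRing A] [Algebra R A] [IsLocalization.AtPrime A m] (I : Ideal R)
    {N : ℕ} (hI : m ^ N ≤ I) :
    Function.Bijective (Ideal.quotientMap (I.map (algebraMap R A)) (algebraMap R A)
      Ideal.le_comap_map) := by
  -- An element outside `m` is coprime to `m ^ N`, hence already invertible modulo `I`.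
  have hunit : ∀ s ∉ m, ∃ t, t * s - 1 ∈ I := by
    intro s hs
    have h1 : IsCoprime (Ideal.span {s}) m := by
      rw [Ideal.isCoprime_iff_sup_eq, sup_comm]
      exact Ideal.IsMaximal.out.2 _ (Submodule.lt_sup_iff_notMem.2 hs)
    have h2 := h1.pow_right (n := N)
    obtain ⟨a, ha, b, hb, hab⟩ := Ideal.isCoprime_iff_exists.1 h2
    obtain ⟨t, rfl⟩ := Ideal.mem_span_singleton'.1 ha
    refine ⟨t, hI ?_⟩
    rw [← hab, sub_add_cancel_left]
    exact neg_mem hb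
  constructor
  · refine Ideal.quotientMap_injective' fun x hx => ?_
    rw [Ideal.mem_comap, IsLocalization.algebraMap_mem_map_algebraMap_iff m.primeCompl] at hx
    obtain ⟨s, hs, hsx⟩ := hx
    obtain ⟨t, ht⟩ := hunit s hs
    have : x = t * (s * x) - (t * s - 1) * x := by ring
    rw [this]
    exact I.sub_mem (I.mul_mem_left _ hsx) (I.mul_mem_right _ ht)
  · intro y
    obtain ⟨y, rfl⟩ := Ideal.Quotient.mk_surjective y
    obtain ⟨x, s, rfl⟩ := IsLocalization.exists_mk'_eq m.primeCompl y
    obtain ⟨t, ht⟩ := hunit s s.2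
    refine ⟨Ideal.Quotient.mk I (t * x), ?_⟩
    rw [Ideal.quotientMap_mk, Ideal.Quotient.eq]
    have h1 := (I.map (algebraMap R A)).mul_mem_left (IsLocalization.mk' A x s)
      (Ideal.mem_map_of_mem (algebraMap R A) ht)
    convert h1 using 1
    rw [map_sub, map_mul, map_one, mul_sub, mul_one, map_mul, mul_left_comm,
      IsLocalization.mk'_spec]

/-- Frobenius powers are computed on generators. -/
theorem frobeniusPower_span {A : Type*} [CommRing A] (p : ℕ) [Fact p.Prime] [CharP A p]
    (S : Set A) (r : ℕ) :
    frobeniusPower (Ideal.span S) (p ^ r) = Ideal.span ((fun a => a ^ p ^ r) '' S) := by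
  refine le_antisymm (Ideal.span_le.2 ?_) (Ideal.span_mono (Set.image_mono Ideal.subset_span))
  rintro _ ⟨a, ha, rfl⟩
  have : Ideal.span S ≤ (Ideal.span ((fun a => a ^ p ^ r) '' S)).comap (iterateFrobenius A p r) := by
    rw [Ideal.span_le]
    intro s hs
    exact Ideal.subset_span ⟨s, hs, rfl⟩
  exact this ha

/-- Every ideal of every localization of a domain `R` is tightly closed if for every `c ≠ 0` and
all large `q = p ^ r` some additive `φ` with `φ (c * x ^ q) = x` and
`φ (a * x ^ q) = φ a * x` exists. -/
theorem isTightlyClosed_of_exists_addMonoidHom {R B : Type*} [CommRing R] [IsDomain R] [CommRing B]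
    [Algebra R B] (p : ℕ) [Fact p.Prime] [CharP R p]
    (hR : ∀ c : R, c ≠ 0 → ∃ N : ℕ, ∀ r : ℕ, N ≤ r →
      ∃ φ : R →+ R, φ c = 1 ∧ ∀ a x : R, φ (a * x ^ p ^ r) = φ a * x)
    (W : Submonoid R) (hW : W ≤ nonZeroDivisors R) [IsLocalization W B] (I : Ideal B) :
    IsTightlyClosed p I := by
  have : IsDomain B := IsLocalization.isDomain_of_le_nonZeroDivisors B hW
  have hinj : Function.Injective (algebraMap R B) := IsLocalization.injective (M := W) B hW
  have : CharP B p := (RingHom.charP_iff _ hinj p).1 ‹_›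
  refine Set.Subset.antisymm ?_ fun x hx => ?_
  · rintro x ⟨c, hc, N, hN⟩
    have hc0 : c ≠ 0 := by
      rintro rfl
      exact hc ⊥ (by rw [IsDomain.minimalPrimes_eq_singleton_bot]; rfl) (zero_mem _)
    obtain ⟨c', w, rfl⟩ := IsLocalization.exists_mk'_eq W c
    obtain ⟨x', v, rfl⟩ := IsLocalization.exists_mk'_eq W x
    have hc' : c' ≠ 0 := by
      rintro rfl
      exact hc0 (IsLocalization.mk'_zero _)
    obtain ⟨N', hN'⟩ := hR c' hc'
    obtain ⟨φ, hφ1, hφ⟩ := hN' (max N N') (le_max_right _ _)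
    set q := p ^ max N N' with hq
    have h1 := hN (max N N') (le_max_left _ _)
    rw [← hq] at h1
    set J := I.comap (algebraMap R B)
    have hIJ : I = J.map (algebraMap R B) := (IsLocalization.map_under W B I).symm
    have hfr : frobeniusPower I q =
        (Ideal.span ((fun a => a ^ q) '' (J : Set R))).map (algebraMap R B) := by
      conv_lhs => rw [hIJ, Ideal.map, hq, frobeniusPower_span p]
      rw [Ideal.map_span, Set.image_image, Set.image_image]
      simp [hq]
    have h2 : algebraMap R B (c' * x' ^ q) ∈ frobeniusPower I q := by
      have : algebraMap R B (c' * x' ^ q) = algebraMap R B (w * v ^ q) *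
          (IsLocalization.mk' B c' w * IsLocalization.mk' B x' v ^ q) := by
        rw [map_mul, map_mul, map_pow, map_pow, ← IsLocalization.mk'_spec B c' w,
          ← IsLocalization.mk'_spec B x' v]
        ring
      rw [this]
      exact Ideal.mul_mem_left _ _ h1
    rw [hfr, IsLocalization.algebraMap_mem_map_algebraMap_iff W] at h2
    obtain ⟨s, hs, h3⟩ := h2
    have hspan : ∀ y ∈ Ideal.span ((fun a => a ^ q) '' (J : Set R)), ∀ b, φ (b * y) ∈ J := by
      intro y hy
      induction hy using Submodule.span_induction with
      | mem y hy =>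
        obtain ⟨a, ha, rfl⟩ := hy
        intro b
        rw [hφ]
        exact J.mul_mem_left _ ha
      | zero => intro b; simp
      | add y z _ _ hy hz => intro b; rw [mul_add, map_add]; exact J.add_mem (hy b) (hz b)
      | smul a y _ hy => intro b; rw [smul_eq_mul, ← mul_assoc]; exact hy _
    -- The denominator `s` occurs to the first power; the factor `s ^ (q - 1)` completes it to a
    -- `q`-th power, which `φ` turns back into `s`.
    have h4 := hspan _ h3 (s ^ (q - 1))
    have hq0 : q ≠ 0 := pow_ne_zero _ (Fact.out : p.Prime).ne_zero
    have h5 : s ^ (q - 1) * (s * (c' * x' ^ q)) = c' * (s * x') ^ q := by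
      rw [mul_pow, ← Nat.succ_pred_eq_of_pos (Nat.pos_of_ne_zero hq0)]
      simp only [Nat.succ_eq_add_one, Nat.add_sub_cancel, Nat.pred_eq_sub_one]
      ring
    rw [h5, hφ, hφ1, one_mul] at h4
    rw [SetLike.mem_coe, hIJ, IsLocalization.mk'_mem_map_algebraMap_iff]
    exact ⟨s, hs, h4⟩
  · refine ⟨1, fun P hP => (Ideal.ne_top_iff_one _).1 hP.1.1.ne_top, 0, fun r _ => ?_⟩
    rw [one_mul]
    exact Ideal.subset_span ⟨x, hx, rfl⟩

/-! ### The semigroup ring of the cone and its monomial ideals. -/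

/-- The cone over the trapezoid with vertices `(0, 0)`, `(1, 0)`, `(1, 1)`, `(-n, 1)`. -/
def scrollCone (n : ℕ) : AddSubmonoid (ℤ × ℤ × ℤ) where
  carrier := {w | 0 ≤ w.2.1 ∧ w.2.1 ≤ w.2.2 ∧ w.1 ≤ w.2.2 ∧ 0 ≤ w.1 + n * w.2.1}
  zero_mem' := by simp
  add_mem' := by
    rintro ⟨a, b, c⟩ ⟨a', b', c'⟩ ⟨h1, h2, h3, h4⟩ ⟨h1', h2', h3', h4'⟩
    simp only [Set.mem_ofPred_eq, Prod.mk_add_mk] at *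
    refine ⟨by linarith, by linarith, by linarith, ?_⟩
    rw [mul_add]
    linarith

theorem mem_scrollCone {n : ℕ} {a b c : ℤ} :
    (a, b, c) ∈ scrollCone n ↔ 0 ≤ b ∧ b ≤ c ∧ a ≤ c ∧ 0 ≤ a + n * b := Iff.rfl

theorem scrollGenerators_eq (k : Type*) [Field k] (n : ℕ) :
    scrollGenerators k n =
      (fun w => AddMonoidAlgebra.single w 1) '' {w | w ∈ scrollCone n ∧ w.2.2 = 1} := by
  ext f
  constructor
  · rintro ((rfl | rfl | rfl | rfl) | ⟨i, hi, hin, rfl⟩)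
    · exact ⟨_, ⟨mem_scrollCone.2 (by simp), rfl⟩, rfl⟩
    · exact ⟨_, ⟨mem_scrollCone.2 (by simp), rfl⟩, rfl⟩
    · exact ⟨_, ⟨mem_scrollCone.2 (by simp; positivity), rfl⟩, rfl⟩
    · exact ⟨_, ⟨mem_scrollCone.2 (by simp), rfl⟩, rfl⟩
    · exact ⟨_, ⟨mem_scrollCone.2 (by simp; omega), rfl⟩, rfl⟩
  · rintro ⟨⟨a, b, c⟩, ⟨hw, hc⟩, rfl⟩
    rw [mem_scrollCone] at hw
    obtain rfl : c = 1 := hc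
    obtain ⟨h1, h2, h3, h4⟩ := hw
    obtain rfl | rfl : b = 0 ∨ b = 1 := by omega
    · obtain rfl | rfl : a = 0 ∨ a = 1 := by omega
      · exact Or.inl (Or.inl rfl)
      · exact Or.inl (Or.inr (Or.inl rfl))
    · obtain rfl | rfl | h : a = 0 ∨ a = 1 ∨ a < 0 := by omega
      · exact Or.inl (Or.inr (Or.inr (Or.inr rfl)))
      · exact Or.inl (Or.inr (Or.inr (Or.inl rfl)))
      · refine Or.inr ⟨(-a).toNat, by omega, by omega, ?_⟩
        rw [laurentMonomial, Int.toNat_of_nonneg (by omega), neg_neg]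

/-- The cone is generated in degree one. -/
theorem exists_sub_mem_scrollCone {n : ℕ} {w : ℤ × ℤ × ℤ} (hw : w ∈ scrollCone n)
    (h : 1 ≤ w.2.2) : ∃ g ∈ scrollCone n, g.2.2 = 1 ∧ w - g ∈ scrollCone n := by
  obtain ⟨a, b, c⟩ := w
  rw [mem_scrollCone] at hw
  obtain ⟨h1, h2, h3, h4⟩ := hw
  simp only at h
  rcases h2.lt_or_eq with h2 | rfl
  · rcases h3.lt_or_eq with h3 | rfl
    · refine ⟨(0, 0, 1), mem_scrollCone.2 (by simp), rfl, mem_scrollCone.2 ?_⟩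
      refine ⟨?_, ?_, ?_, ?_⟩ <;> simp <;> omega
    · refine ⟨(1, 0, 1), mem_scrollCone.2 (by simp), rfl, mem_scrollCone.2 ?_⟩
      refine ⟨?_, ?_, ?_, ?_⟩ <;> simp
      · omega
      · omega
      · nlinarith
  · rcases le_or_gt (a + n * b) n with h5 | h5
    -- The generator is chosen with the same value of `a + n * b` as the exponent, so that the
    -- difference has value 0; in this branch the minimum is `a + n * b`.
    · refine ⟨(min (a + n * b) (n + 1) - n, 1, 1), mem_scrollCone.2 ?_, rfl, mem_scrollCone.2 ?_⟩
      · refine ⟨?_, ?_, ?_, ?_⟩ <;> simp <;> omega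
      · rw [min_eq_left (by omega)]
        refine ⟨?_, ?_, ?_, ?_⟩ <;> simp
        · omega
        · nlinarith
        · linarith
    · refine ⟨(1, 1, 1), mem_scrollCone.2 (by simp; positivity), rfl, mem_scrollCone.2 ?_⟩
      refine ⟨?_, ?_, ?_, ?_⟩ <;> simp
      · omega
      · omega
      · linarith

theorem single_mem_scrollRing (k : Type*) [Field k] {n : ℕ} {w : ℤ × ℤ × ℤ}
    (hw : w ∈ scrollCone n) (r : k) : AddMonoidAlgebra.single w r ∈ scrollRing k n := by
  suffices h : ∀ c : ℕ, ∀ w ∈ scrollCone n, w.2.2 = c →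
      (AddMonoidAlgebra.single w 1 : LaurentRing k) ∈ scrollRing k n by
    have h1 := (scrollRing k n).smul_mem
      (h w.2.2.toNat w hw (Int.toNat_of_nonneg (hw.1.trans hw.2.1)).symm) r
    rwa [AddMonoidAlgebra.smul_single, smul_eq_mul, mul_one] at h1
  intro c
  induction c with
  | zero =>
    rintro ⟨a, b, c⟩ ⟨h1, h2, h3, h4⟩ hc
    simp only [Nat.cast_zero] at *
    obtain rfl : b = 0 := by omega
    obtain rfl : a = 0 := by omega
    subst hc
    exact one_mem _
  | succ c ih =>
    intro w hw hc
    obtain ⟨g, hg, hg1, hgw⟩ := exists_sub_mem_scrollCone hw (by omega)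
    have h1 := ih _ hgw (by simp only [Prod.snd_sub]; push_cast at hc; omega)
    have h2 : (AddMonoidAlgebra.single g 1 : LaurentRing k) ∈ scrollRing k n := by
      refine Algebra.subset_adjoin ?_
      rw [scrollGenerators_eq]
      exact ⟨g, ⟨hg, hg1⟩, rfl⟩
    have := mul_mem h2 h1
    rwa [AddMonoidAlgebra.single_mul_single, add_sub_cancel, one_mul] at this

theorem support_mul_mem_scrollCone {k : Type*} [Field k] {n : ℕ} {f g : LaurentRing k}
    (hf : ∀ u ∈ f.coeff.support, u ∈ scrollCone n) (hg : ∀ u ∈ g.coeff.support, u ∈ scrollCone n) :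
    ∀ u ∈ (f * g).coeff.support, u ∈ scrollCone n := by
  classical
  intro u hu
  obtain ⟨v, hv, w, hw, rfl⟩ := Finset.mem_add.1 (AddMonoidAlgebra.support_coeff_mul_subset f g hu)
  exact add_mem (hf v hv) (hg w hw)

theorem sum_single_mem {k σ : Type*} [Field k] [SetLike σ (LaurentRing k)]
    [AddSubmonoidClass σ (LaurentRing k)] (S : σ) (f : LaurentRing k)
    (h : ∀ u ∈ f.coeff.support, AddMonoidAlgebra.single u (f.coeff u) ∈ S) : f ∈ S := by
  rw [← AddMonoidAlgebra.sum_coeff_single f]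
  exact sum_mem h

theorem mem_scrollRing_iff {k : Type*} [Field k] {n : ℕ} {f : LaurentRing k} :
    f ∈ scrollRing k n ↔ ∀ u ∈ f.coeff.support, u ∈ scrollCone n := by
  classical
  refine ⟨fun hf => ?_, fun hf => sum_single_mem _ f fun u hu => single_mem_scrollRing k (hf u hu) _⟩
  have hsingle : ∀ w ∈ scrollCone n, ∀ r : k,
      ∀ u ∈ (AddMonoidAlgebra.single w r : LaurentRing k).coeff.support, u ∈ scrollCone n := by
    intro w hw r u hu
    rw [AddMonoidAlgebra.coeff_single] at hu
    rwa [Finset.mem_singleton.1 (Finsupp.support_single_subset hu)]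
  induction hf using Algebra.adjoin_induction with
  | mem f hf =>
    rw [scrollGenerators_eq] at hf
    obtain ⟨w, ⟨hw, -⟩, rfl⟩ := hf
    exact hsingle w hw 1
  | algebraMap r => exact hsingle 0 (zero_mem _) r
  | add f g _ _ hf hg =>
    intro u hu
    rw [AddMonoidAlgebra.coeff_add] at hu
    exact (Finset.mem_union.1 (Finsupp.support_add hu)).elim (hf u) (hg u)
  | mul f g _ _ hf hg => exact support_mul_mem_scrollCone hf hg

/-- The monomials of the scroll ring. -/
noncomputable def scrollMonomial (k : Type*) [Field k] {n : ℕ} (w : scrollCone n) :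
    scrollRing k n :=
  ⟨AddMonoidAlgebra.single w 1, single_mem_scrollRing k w.2 1⟩

theorem coeff_scrollMonomial_mul {k : Type*} [Field k] {n : ℕ} (w : scrollCone n)
    (f : scrollRing k n) (u : ℤ × ℤ × ℤ) :
    (scrollMonomial k w * f : scrollRing k n).1.coeff u = f.1.coeff (u - w) := by
  rw [MulMemClass.coe_mul, scrollMonomial, AddMonoidAlgebra.coeff_single_mul_apply, one_mul,
    neg_add_eq_sub]

theorem scrollMonomial_add (k : Type*) [Field k] {n : ℕ} (v w : scrollCone n) :
    scrollMonomial k (v + w) = scrollMonomial k v * scrollMonomial k w := by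
  ext1
  simp [scrollMonomial, AddMonoidAlgebra.single_mul_single]

theorem scrollMonomial_nsmul (k : Type*) [Field k] {n : ℕ} (w : scrollCone n) (q : ℕ) :
    scrollMonomial k (q • w) = scrollMonomial k w ^ q := by
  ext1
  simp [scrollMonomial, AddMonoidAlgebra.single_pow]

/-- An ideal contains an element if it contains its monomials. -/
theorem mem_of_forall_scrollMonomial_mem {k : Type*} [Field k] {n : ℕ}
    (I : Ideal (scrollRing k n)) (f : scrollRing k n)
    (h : ∀ u : scrollCone n, u.1 ∈ f.1.coeff.support → scrollMonomial k u ∈ I) : f ∈ I := by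
  have h1 : f.1 ∈ (I.restrictScalars k).map (scrollRing k n).val.toLinearMap := by
    refine sum_single_mem _ f.1 fun u hu => ?_
    have hu' := mem_scrollRing_iff.1 f.2 u hu
    refine ⟨f.1.coeff u • scrollMonomial k ⟨u, hu'⟩,
      Submodule.smul_mem _ _ (h ⟨u, hu'⟩ hu), ?_⟩
    simp [scrollMonomial]
  obtain ⟨g, hg, hgf⟩ := h1
  obtain rfl : g = f := Subtype.ext hgf
  exact hg

/-- Monomial ideals are determined by exponents. -/
theorem mem_span_scrollMonomial_iff {k : Type*} [Field k] {n : ℕ} (G : Set (scrollCone n))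
    (f : scrollRing k n) :
    f ∈ Ideal.span (scrollMonomial k '' G) ↔
      ∀ u ∈ f.1.coeff.support, ∃ g ∈ G, u - g.1 ∈ scrollCone n := by
  constructor
  · intro hf
    induction hf using Submodule.span_induction with
    | mem f hf =>
      obtain ⟨g, hg, rfl⟩ := hf
      intro u hu
      have := Finsupp.support_single_subset hu
      rw [Finset.mem_singleton] at this
      refine ⟨g, hg, ?_⟩
      rw [this, sub_self]
      exact zero_mem _
    | zero => simp
    | add f g _ _ hf hg =>
      classical
      intro u hu
      exact (Finset.mem_union.1 (Finsupp.support_add hu)).elim (hf u) (hg u)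
    | smul a f _ hf =>
      classical
      intro u hu
      obtain ⟨v, hv, w, hw, rfl⟩ :=
        Finset.mem_add.1 (AddMonoidAlgebra.support_coeff_mul_subset a.1 f.1 hu)
      obtain ⟨g, hg, hgw⟩ := hf w hw
      refine ⟨g, hg, ?_⟩
      rw [add_sub_assoc]
      exact add_mem (mem_scrollRing_iff.1 a.2 v hv) hgw
  · intro h
    refine mem_of_forall_scrollMonomial_mem _ f fun u hu => ?_
    obtain ⟨g, hg, hgu⟩ := h u hu
    have : u = (⟨_, hgu⟩ : scrollCone n) + g := Subtype.ext (sub_add_cancel _ _).symm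
    rw [this, scrollMonomial_add]
    exact Ideal.mul_mem_left _ _ (Ideal.subset_span ⟨g, hg, rfl⟩)

theorem scrollIdeal_eq_span (k : Type*) [Field k] (n : ℕ) :
    scrollIdeal k n = Ideal.span (scrollMonomial k '' {w | w.1.2.2 = 1}) := by
  rw [scrollIdeal, scrollGenerators_eq]
  congr 1
  ext f
  constructor
  · rintro ⟨w, ⟨hw, hw1⟩, h⟩
    exact ⟨⟨w, hw⟩, hw1, Subtype.ext h⟩
  · rintro ⟨w, hw, rfl⟩
    exact ⟨w, ⟨w.2, hw⟩, rfl⟩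

theorem scrollMonomial_mem_scrollIdeal_pow (k : Type*) [Field k] {n : ℕ} (N : ℕ) :
    ∀ w : scrollCone n, (N : ℤ) ≤ w.1.2.2 → scrollMonomial k w ∈ scrollIdeal k n ^ N := by
  induction N with
  | zero => simp
  | succ N ih =>
    intro w hw
    push_cast at hw
    obtain ⟨g, hg, hg1, hgw⟩ := exists_sub_mem_scrollCone w.2 (by omega)
    have : w = (⟨_, hgw⟩ : scrollCone n) + ⟨g, hg⟩ := Subtype.ext (sub_add_cancel _ _).symm
    rw [this, scrollMonomial_add, pow_succ]
    refine Ideal.mul_mem_mul (ih _ ?_) ?_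
    · simp only [Prod.snd_sub]; omega
    · rw [scrollIdeal_eq_span]
      exact Ideal.subset_span ⟨_, hg1, rfl⟩

/-- The powers of the irrelevant ideal are the degree truncations. -/
theorem mem_scrollIdeal_pow_iff {k : Type*} [Field k] {n : ℕ} (N : ℕ) (f : scrollRing k n) :
    f ∈ scrollIdeal k n ^ N ↔ ∀ u ∈ f.1.coeff.support, (N : ℤ) ≤ u.2.2 := by
  refine ⟨fun hf => ?_, fun hf => mem_of_forall_scrollMonomial_mem _ f fun u hu =>
    scrollMonomial_mem_scrollIdeal_pow k N u (hf u hu)⟩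
  induction N generalizing f with
  | zero => exact fun u hu => by simpa using support_scrollRing f.2 u hu
  | succ N ih =>
    rw [pow_succ] at hf
    induction hf using Submodule.mul_induction_on' with
    | mem_mul_mem a ha b hb =>
      push_cast
      exact support_mul_bound (ih a ha) (support_scrollIdeal hb)
    | add a _ b _ ha hb => exact support_add_bound ha hb

instance scrollRing_isNoetherianRing (k : Type*) [Field k] (n : ℕ) :
    IsNoetherianRing (scrollRing k n) := by
  have hfin : (scrollGenerators k n).Finite := by
    refine Set.Finite.union (by simp) ?_
    refine ((Set.finite_Icc 1 n).image fun i : ℕ => laurentMonomial k (-(i : ℤ)) 1 1).subset ?_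
    rintro _ ⟨i, h1, h2, rfl⟩
    exact ⟨i, ⟨h1, h2⟩, rfl⟩
  have : Algebra.FiniteType k (scrollRing k n) :=
    (scrollRing k n).fg_iff_finiteType.1 (Subalgebra.fg_def.2 ⟨_, hfin, rfl⟩)
  exact Algebra.FiniteType.isNoetherianRing k _

/-! ### Tight closure: inverse Frobenius-linear maps. -/

/-- Through `σ`, `L` is a vector space over `K`, and some functional takes the value 1 at a nonzero
vector. With `σ` an iterated Frobenius of `k`, this needs no finiteness of `k` over its `q`-th
powers. -/
theorem exists_addMonoidHom_mul_map {K L : Type*} [Field K] [Field L] (σ : K →+* L) {a : L}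
    (ha : a ≠ 0) : ∃ ψ : L →+ K, ψ a = 1 ∧ ∀ x y, ψ (x * σ y) = ψ x * y := by
  let _ := σ.toAlgebra
  obtain ⟨f, hf⟩ := Module.Projective.exists_dual_eq_one K ha
  refine ⟨f.toAddMonoidHom, hf, fun x y => ?_⟩
  have : x * σ y = y • x := by rw [Algebra.smul_def, mul_comm]; rfl
  rw [this]
  simp [mul_comm]

/-- The map sending `t * x ^ (m + q * v)` to `ψ t * x ^ v`, and monomials with other exponents
to `0`. -/
noncomputable def laurentTrace {k : Type*} [Field k] (ψ : k →+ k) (q : ℕ) (hq : q ≠ 0)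
    (m : ℤ × ℤ × ℤ) : LaurentRing k →+ LaurentRing k where
  toFun f := AddMonoidAlgebra.ofCoeff ((f.coeff.comapDomain (fun v => m + q • v)
    ((add_right_injective m).comp (nsmul_right_injective hq)).injOn).mapRange ψ ψ.map_zero)
  map_zero' := by ext; simp
  map_add' f g := by ext; simp

theorem coeff_laurentTrace {k : Type*} [Field k] (ψ : k →+ k) (q : ℕ) (hq : q ≠ 0)
    (m : ℤ × ℤ × ℤ) (f : LaurentRing k) (v : ℤ × ℤ × ℤ) :
    (laurentTrace ψ q hq m f).coeff v = ψ (f.coeff (m + q • v)) := rfl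

/-- Both sides are additive in `g`, since `q`-th powers are additive in characteristic `p`. For a
monomial `g`, multiplying by `g ^ q` shifts exponents by a multiple of `q`, which the trace turns
into the shift by the exponent of `g`. -/
theorem laurentTrace_mul_pow {k : Type*} [Field k] (p : ℕ) [Fact p.Prime] [CharP k p] (r : ℕ)
    (ψ : k →+ k) (hψ : ∀ x y, ψ (x * y ^ p ^ r) = ψ x * y) (hq : p ^ r ≠ 0)
    (m : ℤ × ℤ × ℤ) (f g : LaurentRing k) :
    laurentTrace ψ (p ^ r) hq m (f * g ^ p ^ r) = laurentTrace ψ (p ^ r) hq m f * g := by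
  have : CharP (LaurentRing k) p := charP_of_injective_algebraMap (algebraMap k _).injective p
  induction g using AddMonoidAlgebra.induction_linear with
  | zero => rw [zero_pow hq, mul_zero, mul_zero, map_zero]
  | add g h hg hh => rw [add_pow_char_pow, mul_add, mul_add, map_add, hg, hh]
  | single w t =>
    ext v
    rw [AddMonoidAlgebra.single_pow, coeff_laurentTrace, AddMonoidAlgebra.coeff_mul_single_apply,
      AddMonoidAlgebra.coeff_mul_single_apply, coeff_laurentTrace, hψ]
    congr 3
    rw [smul_add, smul_neg, add_assoc]

theorem exists_forall_abs_le (S : Finset (ℤ × ℤ × ℤ)) :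
    ∃ B : ℕ, ∀ u ∈ S, |u.1| ≤ B ∧ |u.2.1| ≤ B ∧ |u.2.2| ≤ B := by
  refine ⟨∑ u ∈ S, (u.1.natAbs + u.2.1.natAbs + u.2.2.natAbs), fun u hu => ?_⟩
  have := Finset.single_le_sum (f := fun u : ℤ × ℤ × ℤ => u.1.natAbs + u.2.1.natAbs + u.2.2.natAbs)
    (fun _ _ => Nat.zero_le _) hu
  rw [Int.abs_eq_natAbs, Int.abs_eq_natAbs, Int.abs_eq_natAbs]
  omega

/-- Each of the four facet functionals is at most 2(n + 1)B < q at `m`; a negative integer value at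
`v` would make its value at `m + q • v` negative. -/
theorem mem_scrollCone_of_add_nsmul_mem {n q B : ℕ} {m v : ℤ × ℤ × ℤ}
    (hB : |m.1| ≤ B ∧ |m.2.1| ≤ B ∧ |m.2.2| ≤ B) (hq : 2 * (n + 1) * B < q)
    (h : m + q • v ∈ scrollCone n) : v ∈ scrollCone n := by
  obtain ⟨a, b, c⟩ := v
  obtain ⟨a', b', c'⟩ := m
  simp only [abs_le] at hB
  obtain ⟨⟨h1, h2⟩, ⟨h3, h4⟩, h5, h6⟩ := hB
  simp only [Prod.smul_mk, Prod.mk_add_mk, mem_scrollCone, nsmul_eq_mul] at h ⊢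
  obtain ⟨k1, k2, k3, k4⟩ := h
  have hq' : (2 * (n + 1) * B : ℤ) < q := by exact_mod_cast hq
  have hnB : (0 : ℤ) ≤ n * B := by positivity
  have hB0 : (0 : ℤ) ≤ B := by positivity
  have key : ∀ l l' : ℤ, 0 ≤ l' + q * l → l' ≤ (n + 1) * B * 2 → 0 ≤ l := by
    intro l l' h h'
    by_contra hl
    have : l ≤ -1 := by omega
    nlinarith
  have hnb : n * b' ≤ n * (B : ℤ) := by gcongr
  refine ⟨key _ b' k1 (by nlinarith), ?_, ?_, key _ (a' + n * b') (by linarith) (by nlinarith)⟩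
  · have := key (c - b) (c' - b') (by linarith) (by nlinarith)
    linarith
  · have := key (c - a) (c' - a') (by linarith) (by nlinarith)
    linarith

theorem scrollRing_exists_trace {k : Type*} [Field k] (p : ℕ) [Fact p.Prime] [CharP k p] {n : ℕ}
    (c : scrollRing k n) (hc : c ≠ 0) : ∃ N : ℕ, ∀ r : ℕ, N ≤ r →
      ∃ φ : scrollRing k n →+ scrollRing k n,
        φ c = 1 ∧ ∀ a x : scrollRing k n, φ (a * x ^ p ^ r) = φ a * x := by
  have hc0 : c.1.coeff ≠ 0 := fun h => hc (Subtype.ext (AddMonoidAlgebra.coeff_eq_zero.1 h))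
  obtain ⟨m, hm⟩ := Finsupp.support_nonempty_iff.2 hc0
  obtain ⟨B, hB⟩ := exists_forall_abs_le c.1.coeff.support
  -- As `r < p ^ r`, a lower bound on `r` also bounds `q` from below.
  refine ⟨2 * (n + 1) * B, fun r hr => ?_⟩
  have hq : 2 * (n + 1) * B < p ^ r := hr.trans_lt (Nat.lt_pow_self (Fact.out : p.Prime).one_lt)
  have hq0 : p ^ r ≠ 0 := by omega
  obtain ⟨ψ, hψ1, hψ⟩ := exists_addMonoidHom_mul_map (iterateFrobenius k p r)
    (Finsupp.mem_support_iff.1 hm)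
  have hmap : ∀ f : scrollRing k n, laurentTrace ψ (p ^ r) hq0 m f.1 ∈ scrollRing k n := by
    intro f
    rw [mem_scrollRing_iff]
    intro u hu
    refine mem_scrollCone_of_add_nsmul_mem (hB m hm) hq (mem_scrollRing_iff.1 f.2 _ ?_)
    rw [Finsupp.mem_support_iff, coeff_laurentTrace] at hu
    exact Finsupp.mem_support_iff.2 fun h => hu (by rw [h, map_zero])
  refine ⟨((laurentTrace ψ (p ^ r) hq0 m).comp
    (scrollRing k n).val.toAddMonoidHom).codRestrict _ hmap, ?_, fun a x => Subtype.ext ?_⟩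
  · refine Subtype.ext (AddMonoidAlgebra.ext (Finsupp.ext fun v => ?_))
    change (laurentTrace ψ (p ^ r) hq0 m c.1).coeff v = (1 : LaurentRing k).coeff v
    rw [coeff_laurentTrace, AddMonoidAlgebra.one_def, AddMonoidAlgebra.coeff_single]
    -- Exponents of `c` differ by at most 2B < q in each coordinate, so `m` is the only one
    -- congruent to `m` modulo `q`.
    by_cases hv : v = 0
    · subst hv
      rw [smul_zero, add_zero, hψ1, Finsupp.single_eq_same]
    · rw [Finsupp.single_eq_of_ne hv, Finsupp.notMem_support_iff.1, map_zero]
      intro h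
      apply hv
      have h1 := hB _ h
      have h2 := hB _ hm
      have hq' : (2 * B : ℤ) < (p ^ r : ℕ) := by
        have : 2 * B ≤ 2 * (n + 1) * B := Nat.mul_le_mul_right _ (by omega)
        exact_mod_cast this.trans_lt hq
      have key : ∀ l l' : ℤ, |l'| ≤ B → |l' + (p ^ r : ℕ) * l| ≤ B → l = 0 := by
        intro l l' h h'
        rw [abs_le] at h h'
        by_contra hl
        rcases lt_or_gt_of_ne hl with hl | hl
        · have : l ≤ -1 := by omega
          nlinarith
        · have : 1 ≤ l := by omega
          nlinarith
      simp only [Prod.fst_add, Prod.snd_add, nsmul_eq_mul] at h1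
      exact Prod.ext (key _ _ h2.1 h1.1)
        (Prod.ext (key _ _ h2.2.1 h1.2.1) (key _ _ h2.2.2 h1.2.2))
  · exact laurentTrace_mul_pow p r ψ hψ hq0 m a.1 x.1

instance scrollRing_charP (k : Type*) [Field k] (p : ℕ) [CharP k p] (n : ℕ) :
    CharP (scrollRing k n) p :=
  charP_of_injective_algebraMap (algebraMap k _).injective p

theorem scrollLocalRing_isFRationalLocal (k : Type*) [Field k] (p : ℕ) [Fact p.Prime] [CharP k p]
    (n : ℕ) : IsFRationalLocal p (ScrollLocalRing k n) := fun J _ =>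
  isTightlyClosed_of_exists_addMonoidHom p (scrollRing_exists_trace p) (scrollIdeal k n).primeCompl
    (Ideal.primeCompl_le_nonZeroDivisors _) J

theorem scrollLocalRing_isFRational (k : Type*) [Field k] (p : ℕ) [Fact p.Prime] [CharP k p]
    (n : ℕ) : IsFRational p (ScrollLocalRing k n) := by
  intro P _ J _
  -- A localization of `A` at a prime is a localization of `R` at the contracted prime, so the maps
  -- on `R` serve again.
  have h := IsLocalization.isLocalization_isLocalization_atPrime_isLocalization
    (scrollIdeal k n).primeCompl (Localization.AtPrime P) P
  exact isTightlyClosed_of_exists_addMonoidHom p (scrollRing_exists_trace p)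
    (P.comap (algebraMap (scrollRing k n) (ScrollLocalRing k n))).primeCompl
    (Ideal.primeCompl_le_nonZeroDivisors _) J

/-! ### Dimension and Cohen--Macaulayness. -/

/-- Modulo `rs` the maximal ideal is nilpotent, so the quotient has dimension 0, and each term of a
regular sequence lowers the dimension by one. -/
theorem ringKrullDim_eq_length_of_isRegular {A : Type*} [CommRing A] [IsLocalRing A]
    [IsNoetherianRing A] {rs : List A} (h : RingTheory.Sequence.IsRegular A rs) {N : ℕ}
    (hN : IsLocalRing.maximalIdeal A ^ N ≤ Ideal.ofList rs) : ringKrullDim A = rs.length := by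
  have hne : Ideal.ofList rs ≠ ⊤ := by simpa using h.top_ne_smul.symm
  have : Nontrivial (A ⧸ Ideal.ofList rs) := Ideal.Quotient.nontrivial_iff.2 hne
  have h0 : Ring.KrullDimLE 0 (A ⧸ Ideal.ofList rs) := by
    refine Ring.KrullDimLE.mk₀ fun P hP => ?_
    have hmk := Ideal.Quotient.mk_surjective (I := Ideal.ofList rs)
    have h1 : IsLocalRing.maximalIdeal A ≤ P.comap (Ideal.Quotient.mk (Ideal.ofList rs)) := by
      refine (Ideal.IsPrime.comap _).le_of_pow_le (hN.trans fun x hx => ?_)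
      rw [Ideal.mem_comap, Ideal.Quotient.eq_zero_iff_mem.2 hx]
      exact zero_mem _
    have h2 : (P.comap (Ideal.Quotient.mk (Ideal.ofList rs))).IsMaximal := by
      rw [← (IsLocalRing.maximalIdeal.isMaximal A).eq_of_le (Ideal.IsPrime.comap _).ne_top h1]
      infer_instance
    rw [← Ideal.map_comap_of_surjective _ hmk P]
    exact h2.map_of_surjective_of_ker_le hmk fun x hx => by
      rw [Ideal.mem_comap, (RingHom.mem_ker).1 hx]
      exact zero_mem _
  rw [← ringKrullDim_add_length_eq_ringKrullDim_of_isRegular rs h,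
    ringKrullDimZero_iff_ringKrullDim_eq_zero.1 h0, zero_add]

/-- Dividing by a regular sequence subtracts its length from the dimension and leaves a nonnegative
number, so no regular sequence is longer than `rs`. -/
theorem isCohenMacaulayLocal_of_isRegular {A : Type*} [CommRing A] [IsLocalRing A]
    [IsNoetherianRing A] {rs : List A} (h : RingTheory.Sequence.IsRegular A rs)
    (hrs : ringKrullDim A = rs.length) : IsCohenMacaulayLocal A := by
  refine ⟨‹_›, ?_⟩
  rw [hrs]
  suffices localDepth A = rs.length by rw [this]; rfl
  refine le_antisymm (iSup₂_le fun ss hss => ?_) (le_iSup₂_of_le rs ⟨fun r hr => ?_, h⟩ le_rfl)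
  · have hne : Ideal.ofList ss ≠ ⊤ := by simpa using hss.2.top_ne_smul.symm
    have : Nontrivial (A ⧸ Ideal.ofList ss) := Ideal.Quotient.nontrivial_iff.2 hne
    have h1 := ringKrullDim_add_length_eq_ringKrullDim_of_isRegular ss hss.2
    rw [hrs] at h1
    have h2 : (ss.length : WithBot ℕ∞) ≤ rs.length := by
      rw [← h1]
      exact le_add_of_nonneg_left ringKrullDim_nonneg_of_nontrivial
    exact_mod_cast h2
  · have hne : Ideal.ofList rs ≠ ⊤ := by simpa using h.top_ne_smul.symm
    exact IsLocalRing.le_maximalIdeal hne (Ideal.subset_span hr)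

/-- The monomials `T`, `xyT`, `xT`, `x⁻ⁿyT`. -/
def scrollVertex (n : ℕ) : Fin 4 → scrollCone n
  | 0 => ⟨(0, 0, 1), mem_scrollCone.2 (by simp)⟩
  | 1 => ⟨(1, 1, 1), mem_scrollCone.2 (by simp; positivity)⟩
  | 2 => ⟨(1, 0, 1), mem_scrollCone.2 (by simp)⟩
  | 3 => ⟨(-n, 1, 1), mem_scrollCone.2 (by simp)⟩

/-- The system of parameters `T, xyT, xT - x⁻ⁿyT`. -/
noncomputable def scrollParameters (k : Type*) [Field k] (n : ℕ) : List (scrollRing k n) :=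
  [scrollMonomial k (scrollVertex n 0), scrollMonomial k (scrollVertex n 1),
    scrollMonomial k (scrollVertex n 2) - scrollMonomial k (scrollVertex n 3)]

theorem mem_ofList_take_two {k : Type*} [Field k] {n : ℕ} (f : scrollRing k n) :
    f ∈ Ideal.ofList ((scrollParameters k n).take 2) ↔ ∀ u ∈ f.1.coeff.support,
      u - (0, 0, 1) ∈ scrollCone n ∨ u - (1, 1, 1) ∈ scrollCone n := by
  have : Ideal.ofList ((scrollParameters k n).take 2) =
      Ideal.span (scrollMonomial k '' {scrollVertex n 0, scrollVertex n 1}) := by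
    rw [Ideal.ofList, Set.image_pair]
    congr 1
    ext x
    simp [scrollParameters]
  rw [this, mem_span_scrollMonomial_iff]
  simp [scrollVertex]

theorem mem_ofList_take_one {k : Type*} [Field k] {n : ℕ} (f : scrollRing k n) :
    f ∈ Ideal.ofList ((scrollParameters k n).take 1) ↔ ∀ u ∈ f.1.coeff.support,
      u - (0, 0, 1) ∈ scrollCone n := by
  have : Ideal.ofList ((scrollParameters k n).take 1) =
      Ideal.span (scrollMonomial k '' {scrollVertex n 0}) := by
    rw [Ideal.ofList, Set.image_singleton]
    congr 1
    ext x
    simp [scrollParameters]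
  rw [this, mem_span_scrollMonomial_iff]
  simp [scrollVertex]

/-- The exponents that survive modulo `T, xyT`. -/
theorem scrollCone_residual {n : ℕ} {a b c : ℤ} (h : (a, b, c) ∈ scrollCone n)
    (h1 : (a, b, c) - (0, 0, 1) ∉ scrollCone n) (h2 : (a, b, c) - (1, 1, 1) ∉ scrollCone n) :
    (b = 0 ∧ a = c) ∨ (1 ≤ b ∧ b = c ∧ a + n * b ≤ n) := by
  simp only [Prod.mk_sub_mk, mem_scrollCone, sub_zero] at h h1 h2
  obtain ⟨k1, k2, k3, k4⟩ := h
  -- Subtracting the exponent of T lowers only c - b and c - a; subtracting that of xyT lowers only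
  -- b (by 1) and a + n b (by n + 1).
  have h1' : b = c ∨ a = c := by
    by_contra! hh
    exact h1 ⟨k1, by omega, by omega, k4⟩
  have h2' : b = 0 ∨ a + n * b ≤ n := by
    by_contra! hh
    exact h2 ⟨by omega, by omega, by omega, by linarith [hh.2]⟩
  rcases k1.eq_or_lt' with rfl | hb
  · left
    rw [mul_zero, add_zero] at k4
    exact ⟨rfl, by omega⟩
  · right
    have h3 := h2'.resolve_left hb.ne'
    refine ⟨hb, h1'.resolve_right ?_, h3⟩
    rintro rfl
    nlinarith

theorem coeff_scrollParameters_mul {k : Type*} [Field k] {n : ℕ} (f : scrollRing k n)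
    (u : ℤ × ℤ × ℤ) :
    ((scrollMonomial k (scrollVertex n 2) - scrollMonomial k (scrollVertex n 3)) * f :
      scrollRing k n).1.coeff u = f.1.coeff (u - (1, 0, 1)) - f.1.coeff (u - (-(n : ℤ), 1, 1)) := by
  rw [sub_mul, AddSubgroupClass.coe_sub, AddMonoidAlgebra.coeff_sub, Finsupp.sub_apply,
    coeff_scrollMonomial_mul, coeff_scrollMonomial_mul]
  rfl

theorem coeff_eq_zero_of_notMem {k : Type*} [Field k] {n : ℕ} (f : scrollRing k n)
    {u : ℤ × ℤ × ℤ} (hu : u ∉ scrollCone n) : f.1.coeff u = 0 :=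
  Finsupp.notMem_support_iff.1 fun h => hu (mem_scrollRing_iff.1 f.2 u h)

/-- For the third element, the exponents surviving modulo T, xyT form two families. Adding the
exponent of xT preserves the first, adding that of x⁻ⁿyT preserves the second. At the shifted
exponent the other term of the difference contributes nothing, since its exponent leaves the cone;
so a surviving term of `f` gives a surviving term of the product. -/
theorem scrollParameters_isWeaklyRegular (k : Type*) [Field k] (n : ℕ) :
    RingTheory.Sequence.IsWeaklyRegular (scrollRing k n) (scrollParameters k n) := by
  refine ⟨fun i hi => ?_⟩
  rw [isSMulRegular_quotient_iff_mem_of_smul_mem]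
  have hi3 : i < 3 := hi
  intro f hf
  rw [smul_eq_mul, Ideal.mul_top] at *
  interval_cases i
  · have h0 : scrollMonomial k (scrollVertex n 0) ≠ 0 := fun h => by
      have := congrArg Subtype.val h
      simp [scrollMonomial] at this
    have h1 : scrollMonomial k (scrollVertex n 0) * f ∈ (Ideal.ofList [] : Ideal _) := hf
    rw [Ideal.ofList_nil, Ideal.mem_bot] at h1
    rw [(mul_eq_zero.1 h1).resolve_left h0]
    exact zero_mem _
  · have h1 : scrollMonomial k (scrollVertex n 1) * f ∈
      Ideal.ofList ((scrollParameters k n).take 1) := hf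
    rw [mem_ofList_take_one] at h1 ⊢
    rintro ⟨a, b, c⟩ hu
    have hc := mem_scrollRing_iff.1 f.2 _ hu
    have h2 := h1 ((a, b, c) + (1, 1, 1)) (by
      rw [Finsupp.mem_support_iff, coeff_scrollMonomial_mul]
      simpa [scrollVertex] using hu)
    simp only [Prod.mk_sub_mk, Prod.mk_add_mk, mem_scrollCone] at h2 hc ⊢
    refine ⟨?_, ?_, ?_, ?_⟩ <;> linarith
  · have h1 : (scrollMonomial k (scrollVertex n 2) - scrollMonomial k (scrollVertex n 3)) * f ∈
      Ideal.ofList ((scrollParameters k n).take 2) := hf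
    rw [mem_ofList_take_two] at h1 ⊢
    rintro ⟨a, b, c⟩ hu
    have hc := mem_scrollRing_iff.1 f.2 _ hu
    by_contra! hh
    rcases scrollCone_residual hc hh.1 hh.2 with ⟨rfl, rfl⟩ | ⟨hb, rfl, hn⟩
    · have h2 := h1 ((a, 0, a) + (1, 0, 1)) (by
        rw [Finsupp.mem_support_iff, coeff_scrollParameters_mul, add_sub_cancel_right,
          coeff_eq_zero_of_notMem f (u := (a, 0, a) + (1, 0, 1) - _), sub_zero]
        · exact Finsupp.mem_support_iff.1 hu
        · simp [mem_scrollCone])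
      simp [mem_scrollCone] at h2
    · have h2 := h1 ((a, b, b) + (-(n : ℤ), 1, 1)) (by
        rw [Finsupp.mem_support_iff, coeff_scrollParameters_mul, add_sub_cancel_right,
          coeff_eq_zero_of_notMem f (u := (a, b, b) + (-(n : ℤ), 1, 1) - (1, 0, 1)), zero_sub, neg_ne_zero]
        · exact Finsupp.mem_support_iff.1 hu
        · simp [mem_scrollCone])
      simp only [Prod.mk_sub_mk, Prod.mk_add_mk, mem_scrollCone] at h2
      rcases h2 with h2 | h2
      · linarith [h2.2.1]
      · have := h2.2.2.2
        rw [add_sub_cancel_right] at this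
        linarith

/-- Modulo the parameters, xT and x⁻ⁿyT are interchangeable. A surviving monomial of degree at least
2 has one of them as a factor, and exchanging it for the other yields a multiple of T. -/
theorem scrollIdeal_sq_le (k : Type*) [Field k] (n : ℕ) :
    scrollIdeal k n ^ 2 ≤ Ideal.ofList (scrollParameters k n) := by
  set J := Ideal.ofList (scrollParameters k n)
  have hle : Ideal.ofList ((scrollParameters k n).take 2) ≤ J :=
    Ideal.span_mono fun x hx => List.mem_of_mem_take hx
  have hmono : ∀ u : scrollCone n, (u.1 - (0, 0, 1) ∈ scrollCone n ∨ u.1 - (1, 1, 1) ∈ scrollCone n) →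
      scrollMonomial k u ∈ J := by
    intro u hu
    refine hle ((mem_ofList_take_two _).2 fun v hv => ?_)
    have := Finsupp.support_single_subset hv
    rw [Finset.mem_singleton] at this
    rwa [this]
  have hθ : scrollMonomial k (scrollVertex n 2) - scrollMonomial k (scrollVertex n 3) ∈ J :=
    Ideal.subset_span (by simp [scrollParameters])
  intro f hf
  rw [mem_scrollIdeal_pow_iff] at hf
  refine mem_of_forall_scrollMonomial_mem _ f fun u hu => ?_
  by_cases h : u.1 - (0, 0, 1) ∈ scrollCone n ∨ u.1 - (1, 1, 1) ∈ scrollCone n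
  · exact hmono u h
  have hc := hf u hu
  obtain ⟨⟨a, b, c⟩, hw⟩ := u
  push Not at h
  simp only [Nat.cast_ofNat] at hc
  rcases scrollCone_residual hw h.1 h.2 with ⟨rfl, rfl⟩ | ⟨hb, rfl, hn⟩
  · have h1 : (a - 1, 0, a - 1) ∈ scrollCone n := by
      rw [mem_scrollCone]
      refine ⟨?_, ?_, ?_, ?_⟩ <;> linarith
    have h2 : (⟨(a, 0, a), hw⟩ : scrollCone n) = ⟨_, h1⟩ + scrollVertex n 2 :=
      Subtype.ext (by simp [scrollVertex])
    have h3 : scrollMonomial k (⟨_, h1⟩ + scrollVertex n 3) ∈ J := by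
      refine hmono _ (Or.inl ?_)
      simp only [scrollVertex, AddMemClass.mk_add_mk, Prod.mk_add_mk, Prod.mk_sub_mk,
        mem_scrollCone]
      refine ⟨?_, ?_, ?_, ?_⟩ <;> linarith
    rw [scrollMonomial_add] at h3
    rw [h2, scrollMonomial_add]
    have := J.add_mem (J.mul_mem_left (scrollMonomial k ⟨_, h1⟩) hθ) h3
    rwa [mul_sub, sub_add_cancel] at this
  · have hnb : n * (2 : ℤ) ≤ n * b := by gcongr
    have h1 : (a + n, b - 1, b - 1) ∈ scrollCone n := by
      rw [mem_scrollCone] at hw ⊢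
      refine ⟨?_, ?_, ?_, ?_⟩ <;> linarith
    have h2 : (⟨(a, b, b), hw⟩ : scrollCone n) = ⟨_, h1⟩ + scrollVertex n 3 :=
      Subtype.ext (by simp [scrollVertex])
    have h3 : scrollMonomial k (⟨_, h1⟩ + scrollVertex n 2) ∈ J := by
      refine hmono _ (Or.inl ?_)
      rw [mem_scrollCone] at hw
      simp only [scrollVertex, AddMemClass.mk_add_mk, Prod.mk_add_mk, Prod.mk_sub_mk,
        mem_scrollCone]
      refine ⟨?_, ?_, ?_, ?_⟩ <;> linarith
    rw [scrollMonomial_add] at h3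
    rw [h2, scrollMonomial_add]
    have := J.sub_mem h3 (J.mul_mem_left (scrollMonomial k ⟨_, h1⟩) hθ)
    rwa [mul_sub, sub_sub_cancel] at this

theorem scrollLocalRing_isRegular (k : Type*) [Field k] (n : ℕ) :
    RingTheory.Sequence.IsRegular (ScrollLocalRing k n)
      ((scrollParameters k n).map (algebraMap _ (ScrollLocalRing k n))) := by
  refine (scrollParameters_isWeaklyRegular k n).isRegular_of_isLocalization_of_mem _
    (scrollIdeal k n) ?_
  have h : ∀ i, scrollMonomial k (scrollVertex n i) ∈ scrollIdeal k n := by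
    intro i
    rw [scrollIdeal_eq_span]
    refine Ideal.subset_span ⟨_, ?_, rfl⟩
    fin_cases i <;> rfl
  simp only [scrollParameters, List.mem_cons, List.not_mem_nil, or_false, forall_eq_or_imp,
    forall_eq]
  exact ⟨h 0, h 1, sub_mem (h 2) (h 3)⟩

theorem scrollLocalRing_ringKrullDim (k : Type*) [Field k] (n : ℕ) :
    ringKrullDim (ScrollLocalRing k n) = 3 := by
  rw [ringKrullDim_eq_length_of_isRegular (scrollLocalRing_isRegular k n) (N := 2)]
  · rfl
  · rw [← Localization.AtPrime.map_eq_maximalIdeal, ← Ideal.map_pow, ← Ideal.map_ofList]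
    exact Ideal.map_mono (scrollIdeal_sq_le k n)

theorem scrollLocalRing_isCohenMacaulayLocal (k : Type*) [Field k] (n : ℕ) :
    IsCohenMacaulayLocal (ScrollLocalRing k n) :=
  isCohenMacaulayLocal_of_isRegular (scrollLocalRing_isRegular k n)
    (scrollLocalRing_ringKrullDim k n)

/-! ### Lengths as numbers of exponents. -/

theorem exists_linearMap_coeff (k : Type*) [Field k] {n : ℕ} (F : Finset (ℤ × ℤ × ℤ))
    (hF : ∀ u ∈ F, u ∈ scrollCone n) : ∃ φ : scrollRing k n →ₗ[k] (F → k),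
      Function.Surjective φ ∧ ∀ f u, φ f u = f.1.coeff u := by
  classical
  let φ : scrollRing k n →ₗ[k] (F → k) :=
    { toFun := fun f u => f.1.coeff u
      map_add' := fun f g => rfl
      map_smul' := fun r f => rfl }
  have hφ : ∀ f u, φ f u = f.1.coeff u := fun _ _ => rfl
  refine ⟨φ, fun g => ?_, hφ⟩
  refine ⟨∑ u : F, g u • scrollMonomial k ⟨u, hF u u.2⟩, funext fun v => ?_⟩
  rw [map_sum, Finset.sum_apply, Finset.sum_eq_single v]
  · simp [hφ, scrollMonomial]
  · intro u _ huv
    simp [hφ, scrollMonomial, huv]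
  · simp

theorem exists_linearMap_quotientMap (k : Type*) {R : Type*} (A : Type*) [Field k] [CommRing R]
    [CommRing A] [Algebra k R] [Algebra R A] [Algebra k A] [IsScalarTower k R A] (I : Ideal R) :
    ∃ ψ : R →ₗ[k] A ⧸ I.map (algebraMap R A), ∀ f, ψ f =
      Ideal.quotientMap (I.map (algebraMap R A)) (algebraMap R A) Ideal.le_comap_map
        (Ideal.Quotient.mk I f) :=
  ⟨((Ideal.Quotient.mkₐ k (I.map (algebraMap R A))).comp
    (IsScalarTower.toAlgHom k R A)).toLinearMap, fun _ => rfl⟩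

/-- The length of `A ⧸ I A` is the number of exponents outside the monomial ideal `I`. -/
theorem length_quotient_map_of_isLocalization {k : Type*} [Field k] {n : ℕ} (A : Type*)
    [CommRing A] [IsLocalRing A] [Algebra (scrollRing k n) A]
    [IsLocalization.AtPrime A (scrollIdeal k n)] [Algebra k A]
    [IsScalarTower k (scrollRing k n) A] (I : Ideal (scrollRing k n)) {N : ℕ} (hI : scrollIdeal k n ^ N ≤ I) (F : Finset (ℤ × ℤ × ℤ)) (hF : ∀ u ∈ F, u ∈ scrollCone n)
    (hIF : ∀ f : scrollRing k n, f ∈ I ↔ ∀ u ∈ F, f.1.coeff u = 0) :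
    Module.length A (A ⧸ I.map (algebraMap _ A)) = F.card := by
  have hbij := bijective_quotientMap_localization_atPrime (scrollIdeal k n) A I hI
  obtain ⟨ψ, hψ⟩ := exists_linearMap_quotientMap k A I
  obtain ⟨φ, hφ⟩ := exists_linearMap_coeff k F hF
  have hker : LinearMap.ker ψ = LinearMap.ker φ := by
    ext f
    rw [LinearMap.mem_ker, LinearMap.mem_ker, hψ, map_eq_zero_iff _ hbij.1,
      Ideal.Quotient.eq_zero_iff_mem, hIF, funext_iff, Subtype.forall]
    simp only [hφ.2, Pi.zero_apply]
  have hψs : Function.Surjective ψ := by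
    intro y
    obtain ⟨z, rfl⟩ := hbij.2 y
    obtain ⟨f, rfl⟩ := Ideal.Quotient.mk_surjective z
    exact ⟨f, hψ f⟩
  -- Both `ψ` and the coefficient map `φ` are surjective on `R` with kernel `I`.
  have e : (A ⧸ I.map (algebraMap _ A)) ≃ₗ[k] (F → k) :=
    (ψ.quotKerEquivOfSurjective hψs).symm.trans ((Submodule.quotEquivOfEq _ _ hker).trans
      (φ.quotKerEquivOfSurjective hφ.1))
  have hfin : Module.Finite k (A ⧸ I.map (algebraMap _ A)) := Module.Finite.equiv e.symm
  have hlen : IsFiniteLength A (A ⧸ I.map (algebraMap _ A)) :=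
    isFiniteLength_iff_isNoetherian_isArtinian.2
      ⟨isNoetherian_of_tower k inferInstance, isArtinian_of_tower k inferInstance⟩
  rw [hlen.length_eq_length_residueField (k := k), e.length_eq, Module.length_of_free_of_finite]
  · simp
  -- The residue field of `A` is `k`: modulo the maximal ideal, every element of `A` comes from `R`,
  -- hence from a scalar.
  · intro a
    have h1 := (bijective_quotientMap_localization_atPrime (scrollIdeal k n) A (scrollIdeal k n)
      (N := 1) (pow_one _).le).2 (Ideal.Quotient.mk _ a)
    obtain ⟨x, hx⟩ := h1
    obtain ⟨x, rfl⟩ := Ideal.Quotient.mk_surjective x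
    obtain ⟨r, hr⟩ := exists_sub_mem_scrollIdeal x.2
    rw [Ideal.quotientMap_mk, eq_comm, Ideal.Quotient.eq, IsLocalization.AtPrime.map_eq_maximalIdeal (scrollIdeal k n) A]
      at hx
    refine ⟨r, ?_⟩
    have h2 := Ideal.mem_map_of_mem (algebraMap _ A) hr
    rw [IsLocalization.AtPrime.map_eq_maximalIdeal (scrollIdeal k n) A, map_sub] at h2
    have h3 := add_mem hx h2
    rwa [sub_add_sub_cancel, ← IsScalarTower.algebraMap_apply] at h3

/-! ### The Hilbert--Samuel multiplicity. -/

/-- The exponents of degree less than `N`. -/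
def scrollTruncation (n N : ℕ) : Finset (ℤ × ℤ × ℤ) :=
  ((Finset.range N).sigma fun c => (Finset.range (c + 1)).sigma fun b =>
    Finset.range (c + n * b + 1)).image
    fun t : (_ : ℕ) × (_ : ℕ) × ℕ => ((t.2.2 : ℤ) - n * t.2.1, (t.2.1 : ℤ), (t.1 : ℤ))

theorem mem_scrollTruncation {n N : ℕ} {u : ℤ × ℤ × ℤ} :
    u ∈ scrollTruncation n N ↔ u ∈ scrollCone n ∧ u.2.2 < N := by
  obtain ⟨a, b, c⟩ := u
  simp only [scrollTruncation, Finset.mem_image, Finset.mem_sigma, Finset.mem_range,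
    mem_scrollCone]
  constructor
  · rintro ⟨⟨c', b', i⟩, ⟨h1, h2, h3⟩, h⟩
    simp only [Prod.mk.injEq] at h h1 h2 h3
    obtain ⟨rfl, rfl, rfl⟩ := h
    zify at h1 h2 h3
    refine ⟨⟨?_, ?_, ?_, ?_⟩, ?_⟩ <;> linarith
  · rintro ⟨⟨h1, h2, h3, h4⟩, h5⟩
    have h1' := h1.trans h2
    lift b to ℕ using h1
    lift c to ℕ using h1'
    refine ⟨⟨c, b, (a + n * b).toNat⟩, ⟨by exact_mod_cast h5, by
      exact Nat.lt_succ_of_le (by exact_mod_cast h2), ?_⟩, ?_⟩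
    · zify
      rw [Int.toNat_of_nonneg h4]
      linarith
    · simp only [Int.toNat_of_nonneg h4, add_sub_cancel_right]

theorem card_scrollTruncation (n N : ℕ) : ((scrollTruncation n N).card : ℝ) =
    (N * (N + 1) * (2 * N + 1) + n * ((N - 1) * N * (N + 1))) / 6 := by
  rw [scrollTruncation, Finset.card_image_of_injective, Finset.card_sigma]
  · simp only [Finset.card_sigma, Finset.card_range]
    -- For fixed b and c, the number a + n b takes the c + n b + 1 values from 0 to c + n b.
    have h1 : ∀ c m : ℕ, ((∑ b ∈ Finset.range m, (c + n * b + 1) : ℕ) : ℝ) =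
        m * (c + 1) + n * (m * (m - 1)) / 2 := by
      intro c m
      induction m with
      | zero => simp
      | succ m ih => rw [Finset.sum_range_succ, Nat.cast_add, ih]; push_cast; ring
    induction N with
    | zero => simp
    | succ N ih => rw [Finset.sum_range_succ, Nat.cast_add, ih, h1]; push_cast; ring
  · rintro ⟨c, b, i⟩ ⟨c', b', i'⟩ h
    simp only [Prod.mk.injEq, Nat.cast_inj] at h
    obtain ⟨h, rfl, rfl⟩ := h
    obtain rfl : i = i' := by
      have : (i : ℤ) = i' := by linarith
      exact_mod_cast this
    rfl

theorem hasMultiplicity_of_isLocalization (k : Type*) [Field k] (n : ℕ) (A : Type*)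
    [CommRing A] [IsLocalRing A] [Algebra (scrollRing k n) A]
    [IsLocalization.AtPrime A (scrollIdeal k n)] [Algebra k A]
    [IsScalarTower k (scrollRing k n) A] (hd : ringKrullDim A = 3) :
    HasMultiplicity (IsLocalRing.maximalIdeal A) (n + 2) := by
  have hlen : ∀ N : ℕ, Module.length A (A ⧸ IsLocalRing.maximalIdeal A ^ N) =
      (scrollTruncation n N).card := by
    intro N
    rw [← IsLocalization.AtPrime.map_eq_maximalIdeal (scrollIdeal k n) A, ← Ideal.map_pow]
    refine length_quotient_map_of_isLocalization A _ le_rfl _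
      (fun u hu => (mem_scrollTruncation.1 hu).1) fun f => ?_
    rw [mem_scrollIdeal_pow_iff]
    constructor
    · intro h u hu
      by_contra hne
      exact absurd (h u (Finsupp.mem_support_iff.2 hne)) (mem_scrollTruncation.1 hu).2.not_ge
    · intro h u hu
      by_contra! hlt
      exact Finsupp.mem_support_iff.1 hu
        (h u (mem_scrollTruncation.2 ⟨mem_scrollRing_iff.1 f.2 u hu, hlt⟩))
  refine ⟨fun N => by rw [hlen]; exact ENat.natCast_ne_top _, 3, hd, ?_⟩
  have hlim : Tendsto (fun N : ℕ => (1 + 1 / (N : ℝ)) * (2 + 1 / N) +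
      n * ((1 - 1 / (N : ℝ)) * (1 + 1 / N))) atTop
      (𝓝 ((1 + 0) * (2 + 0) + n * ((1 - 0) * (1 + 0)))) := by
    have h := tendsto_one_div_atTop_nhds_zero_nat (𝕜 := ℝ)
    exact ((h.const_add 1).mul (h.const_add 2)).add
      (((h.const_sub 1).mul (h.const_add 1)).const_mul _)
  have he : ((1 + 0) * (2 + 0) + n * ((1 - 0) * (1 + 0)) : ℝ) = n + 2 := by ring
  rw [he] at hlim
  refine hlim.congr' ?_
  filter_upwards [eventually_gt_atTop 0] with N hN
  rw [hlen, ENat.toNat_natCast, card_scrollTruncation]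
  have : (N : ℝ) ≠ 0 := by positivity
  simp only [Nat.factorial]
  push_cast
  field_simp

/-! ### Exponents outside the Frobenius powers. -/

/-- `q g` divides the exponent `u` for some `g` of degree one. -/
def IsFrobeniusMultiple (n q : ℕ) (u : ℤ × ℤ × ℤ) : Prop :=
  ∃ g ∈ scrollCone n, g.2.2 = 1 ∧ u - q • g ∈ scrollCone n

/-- The exponents `x^(i - nu) y^u T^(u + v)` with `u, v < q`. -/
def frobeniusBox (n q : ℕ) : Finset (ℤ × ℤ × ℤ) :=
  ((Finset.range q ×ˢ Finset.range q).sigma fun t : ℕ × ℕ =>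
    Finset.range ((n + 1) * t.1 + t.2 + 1)).image
    fun t : (_ : ℕ × ℕ) × ℕ => ((t.2 : ℤ) - n * t.1.1, (t.1.1 : ℤ), (t.1.1 + t.1.2 : ℤ))

/-- The triples `i, j < q`, `u` with `(n + 1) u + q ≤ i + j`. -/
def frobeniusCorner (n q : ℕ) : Finset ((_ : ℕ × ℕ) × ℕ) :=
  (Finset.range q ×ˢ Finset.range q).sigma fun t : ℕ × ℕ =>
    if q ≤ t.1 + t.2 then Finset.range ((t.1 + t.2 - q) / (n + 1) + 1) else ∅

/-- The exponents with `v ≥ q` outside the Frobenius power. -/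
def frobeniusLeft (n q : ℕ) : Finset (ℤ × ℤ × ℤ) :=
  (frobeniusCorner n q).image fun t : (_ : ℕ × ℕ) × ℕ =>
    ((t.1.1 : ℤ) - n * t.2, (t.2 : ℤ), (t.1.1 + t.1.2 - n * t.2 : ℤ))

/-- The exponents with `u ≥ q` outside the Frobenius power. -/
def frobeniusRight (n q : ℕ) : Finset (ℤ × ℤ × ℤ) :=
  (Finset.range (n + 1) ×ˢ frobeniusCorner n q).image fun t : ℕ × (_ : ℕ × ℕ) × ℕ =>
    ((t.2.1.1 + q * t.1 - n * (q + t.2.2) : ℤ), (q + t.2.2 : ℤ),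
      (t.2.1.1 + t.2.1.2 - n * t.2.2 : ℤ))

theorem mem_frobeniusCorner {n q i j u : ℕ} : (⟨(i, j), u⟩ : (_ : ℕ × ℕ) × ℕ) ∈ frobeniusCorner n q ↔
    i < q ∧ j < q ∧ (n + 1) * u + q ≤ i + j := by
  simp only [frobeniusCorner, Finset.mem_sigma, Finset.mem_product, Finset.mem_range, and_assoc]
  refine and_congr_right fun _ => and_congr_right fun _ => ?_
  split_ifs with h
  · rw [Finset.mem_range, Nat.lt_succ_iff, Nat.le_div_iff_mul_le (Nat.succ_pos n), mul_comm,
      Nat.le_sub_iff_add_le h]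
  · simp only [Finset.notMem_empty, false_iff]
    intro h'
    exact h (le_trans (Nat.le_add_left _ _) h')

theorem mem_frobeniusBox {n q : ℕ} {a b c : ℤ} : (a, b, c) ∈ frobeniusBox n q ↔
    (a, b, c) ∈ scrollCone n ∧ b < q ∧ c - b < q := by
  simp only [frobeniusBox, Finset.mem_image, Finset.mem_sigma, Finset.mem_range,
    Finset.mem_product, mem_scrollCone]
  constructor
  · rintro ⟨⟨⟨u, v⟩, i⟩, ⟨⟨h1, h2⟩, h3⟩, h⟩
    simp only [Prod.mk.injEq] at h h1 h2 h3
    obtain ⟨rfl, rfl, rfl⟩ := h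
    zify at h1 h2 h3
    refine ⟨⟨?_, ?_, ?_, ?_⟩, ?_, ?_⟩ <;> linarith
  · rintro ⟨⟨h1, h2, h3, h4⟩, h5, h6⟩
    lift b to ℕ using h1
    obtain ⟨v, rfl⟩ := Int.le.dest h2
    obtain ⟨i, hi⟩ := Int.eq_ofNat_of_zero_le h4
    refine ⟨⟨⟨b, v⟩, i⟩, ⟨⟨by simpa using h5, ?_⟩, ?_⟩, ?_⟩
    · simp only; zify; linarith
    · simp only; zify; linarith
    · simp only [Prod.mk.injEq, and_true]; linarith

/-- Since v = i + j - (n + 1) u, the condition v ≥ q is the inequality defining `frobeniusCorner`.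
-/
theorem mem_frobeniusLeft {n q : ℕ} {a b c : ℤ} : (a, b, c) ∈ frobeniusLeft n q ↔
    (a, b, c) ∈ scrollCone n ∧ q ≤ c - b ∧ a + n * b < q ∧ c - a < q := by
  simp only [frobeniusLeft, Finset.mem_image, mem_scrollCone]
  constructor
  · rintro ⟨⟨⟨i, j⟩, u⟩, h1, h⟩
    obtain ⟨h1, h2, h3⟩ := mem_frobeniusCorner.1 h1
    simp only [Prod.mk.injEq] at h
    obtain ⟨rfl, rfl, rfl⟩ := h
    zify at h1 h2 h3
    refine ⟨⟨?_, ?_, ?_, ?_⟩, ?_, ?_, ?_⟩ <;> linarith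
  · rintro ⟨⟨h1, h2, h3, h4⟩, h5, h6, h7⟩
    lift b to ℕ using h1
    obtain ⟨i, hi⟩ := Int.eq_ofNat_of_zero_le h4
    obtain ⟨j, rfl⟩ := Int.le.dest h3
    refine ⟨⟨⟨i, j⟩, b⟩, mem_frobeniusCorner.2 ⟨?_, ?_, ?_⟩, ?_⟩
    · zify; linarith
    · zify; linarith
    · zify; linarith
    · simp only [Prod.mk.injEq, true_and]
      exact ⟨by linarith, by linarith⟩

/-- The condition over `l` says that no generator x^(l - n) yT has its `q`-th power dividing the
monomial, that is, ⌊i / q⌋ + ⌊j / q⌋ ≤ n. As i + j ≥ (n + 1) q, equality holds, and the remainders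
of i and j with u - q form a point of `frobeniusCorner`. -/
theorem mem_frobeniusRight {n q : ℕ} (hq : 0 < q) {a b c : ℤ} : (a, b, c) ∈ frobeniusRight n q ↔
    (a, b, c) ∈ scrollCone n ∧ q ≤ b ∧ c - b < q ∧
      ∀ l : ℤ, 0 ≤ l → l ≤ n + 1 → q * l ≤ a + n * b → c - a < q * (n + 1 - l) := by
  have hq' : (0 : ℤ) < q := by exact_mod_cast hq
  simp only [frobeniusRight, Finset.mem_image, Finset.mem_product, mem_scrollCone]
  constructor
  · rintro ⟨⟨l, ⟨i, j⟩, u⟩, ⟨hl, h1⟩, h⟩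
    obtain ⟨h1, h2, h3⟩ := mem_frobeniusCorner.1 h1
    simp only [Prod.mk.injEq] at h
    rw [Finset.mem_range] at hl
    obtain ⟨rfl, rfl, rfl⟩ := h
    zify at h1 h2 h3 hl
    have hl' : (q : ℤ) * l ≤ q * n := mul_le_mul_of_nonneg_left (by omega) hq'.le
    have hl0 : (0 : ℤ) ≤ q * l := by positivity
    have hnu : (0 : ℤ) ≤ n * u := by positivity
    refine ⟨⟨by positivity, by linarith, by linarith, by linarith⟩, by linarith, by linarith,
      fun l' h0 h4 h5 => ?_⟩
    have : l' ≤ l := by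
      by_contra! hlt
      have : (q : ℤ) * (l + 1) ≤ q * l' := mul_le_mul_of_nonneg_left (by omega) hq'.le
      linarith
    have : (q : ℤ) * l' ≤ q * l := mul_le_mul_of_nonneg_left this hq'.le
    linarith
  · rintro ⟨⟨h1, h2, h3, h4⟩, h5, h6, h7⟩
    obtain ⟨u, rfl⟩ := Int.le.dest h5
    obtain ⟨i, hi⟩ := Int.eq_ofNat_of_zero_le h4
    obtain ⟨j, rfl⟩ := Int.le.dest h3
    have ei : (q : ℤ) * (i / q : ℕ) + (i % q : ℕ) = i := by exact_mod_cast Nat.div_add_mod i q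
    have ej : (q : ℤ) * (j / q : ℕ) + (j % q : ℕ) = j := by exact_mod_cast Nat.div_add_mod j q
    have ri : ((i % q : ℕ) : ℤ) < q := by exact_mod_cast Nat.mod_lt i hq
    have rj : ((j % q : ℕ) : ℤ) < q := by exact_mod_cast Nat.mod_lt j hq
    have ri0 : 0 ≤ ((i % q : ℕ) : ℤ) := by positivity
    have rj0 : 0 ≤ ((j % q : ℕ) : ℤ) := by positivity
    have hnu : (0 : ℤ) ≤ n * u := by positivity
    generalize i % q = i' at *
    generalize j % q = j' at *
    generalize i / q = l at *
    generalize j / q = m at *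
    -- Here `l`, `m` are the quotients and `i'`, `j'` the remainders of `i`, `j` by `q`. The
    -- remainders sum to less than 2q, which gives `hlow`; `h7` gives `hup`.
    have hij : (n + 1 : ℤ) * (q + u) ≤ i + j := by linarith
    have hlow : (n : ℤ) ≤ l + m := by
      by_contra! hlt
      have : (q : ℤ) * (l + m + 1) ≤ q * n := mul_le_mul_of_nonneg_left (by omega) hq'.le
      linarith
    have hup : (l + m : ℤ) ≤ n := by
      by_contra! hlt
      rcases le_or_gt (l : ℤ) (n + 1) with hl | hl
      · have h8 := h7 l (by positivity) hl (by linarith)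
        have : (q : ℤ) * (n + 1) ≤ q * (l + m) := mul_le_mul_of_nonneg_left (by omega) hq'.le
        linarith
      · have : (q : ℤ) * (n + 1) ≤ q * l := mul_le_mul_of_nonneg_left (by omega) hq'.le
        have h8 := h7 (n + 1) (by positivity) le_rfl (by linarith)
        have : (0 : ℤ) ≤ q * m := by positivity
        linarith
    have hlm : (m : ℤ) = n - l := by linarith
    rw [hlm] at ej
    refine ⟨⟨l, ⟨i', j'⟩, u⟩, ⟨Finset.mem_range.2 (by omega), mem_frobeniusCorner.2
      ⟨by exact_mod_cast ri, by exact_mod_cast rj, ?_⟩⟩, ?_⟩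
    · zify; linarith
    · simp only [Prod.mk.injEq, true_and]
      exact ⟨by linarith, by linarith⟩

/-- The exponents outside the Frobenius power. -/
theorem mem_frobenius_complement {n q : ℕ} (hq : 0 < q) {u : ℤ × ℤ × ℤ} :
    u ∈ frobeniusBox n q ∪ frobeniusLeft n q ∪ frobeniusRight n q ↔
      u ∈ scrollCone n ∧ ¬ IsFrobeniusMultiple n q u := by
  obtain ⟨a, b, c⟩ := u
  have hq' : (0 : ℤ) < q := by exact_mod_cast hq
  rw [Finset.mem_union, Finset.mem_union, mem_frobeniusBox, mem_frobeniusLeft,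
    mem_frobeniusRight hq, ← and_or_left, ← and_or_left]
  refine and_congr_right fun hc => ?_
  rw [mem_scrollCone] at hc
  obtain ⟨k1, k2, k3, k4⟩ := hc
  constructor
  · rintro h ⟨⟨g1, g2, g3⟩, hg, hg1, hm⟩
    simp only at hg1
    subst hg1
    simp only [Prod.smul_mk, Prod.mk_sub_mk, mem_scrollCone, nsmul_eq_mul, mul_one] at hg hm
    obtain ⟨e1, e2, e3, e4⟩ := hg
    obtain ⟨f1, f2, f3, f4⟩ := hm
    have hg2 : g2 = 0 ∨ g2 = 1 := by omega
    rcases hg2 with rfl | rfl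
    · have hg1 : g1 = 0 ∨ g1 = 1 := by
        rw [mul_zero] at e4
        omega
      rcases hg1 with rfl | rfl
      · rcases h with (h | h) | h
        · linarith [h.2]
        · linarith [h.2.2]
        · linarith [h.2.1]
      · rcases h with (h | h) | h
        · linarith [h.2]
        · linarith [h.2.1]
        · linarith [h.2.1]
    · rcases h with (h | h) | h
      · linarith [h.1]
      -- With b ≥ q and c - b ≥ q, the sum of a + n b and c - a would be at least (n + 2) q, but
      -- both are below q.
      · have : (0 : ℤ) ≤ n * (b - q) := mul_nonneg (by positivity) (by linarith)
        have : (0 : ℤ) ≤ n * q := by positivity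
        linarith [h.1, h.2.1, h.2.2]
      · have := h.2.2 (g1 + n) (by linarith) (by linarith) (by linarith)
        linarith
  · intro h
    by_contra! hh
    obtain ⟨⟨hA, hB⟩, hC⟩ := hh
    apply h
    rcases le_or_gt (q : ℤ) (c - b) with hv | hv
    · rcases le_or_gt (q : ℤ) (a + n * b) with hi | hi
      · refine ⟨(1, 0, 1), mem_scrollCone.2 (by simp), rfl, ?_⟩
        simp only [Prod.smul_mk, Prod.mk_sub_mk, mem_scrollCone, nsmul_eq_mul, mul_one, mul_zero]
        refine ⟨?_, ?_, ?_, ?_⟩ <;> linarith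
      · have := hB hv hi
        refine ⟨(0, 0, 1), mem_scrollCone.2 (by simp), rfl, ?_⟩
        simp only [Prod.smul_mk, Prod.mk_sub_mk, mem_scrollCone, nsmul_eq_mul, mul_one, mul_zero]
        refine ⟨?_, ?_, ?_, ?_⟩ <;> linarith
    · have hu : (q : ℤ) ≤ b := by
        by_contra! hlt
        linarith [hA hlt]
      obtain ⟨l, l1, l2, l3, l4⟩ := hC hu hv
      refine ⟨(l - n, 1, 1), mem_scrollCone.2 ?_, rfl, ?_⟩
      · refine ⟨?_, ?_, ?_, ?_⟩ <;> linarith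
      · simp only [Prod.smul_mk, Prod.mk_sub_mk, mem_scrollCone, nsmul_eq_mul, mul_one]
        refine ⟨?_, ?_, ?_, ?_⟩ <;> linarith

theorem card_frobenius_complement {n q : ℕ} (hq : 0 < q) :
    (frobeniusBox n q ∪ frobeniusLeft n q ∪ frobeniusRight n q).card =
      (∑ u ∈ Finset.range q, ∑ v ∈ Finset.range q, ((n + 1) * u + v + 1)) +
        (n + 2) * (frobeniusCorner n q).card := by
  have hq' : (0 : ℤ) < q := by exact_mod_cast hq
  rw [Finset.card_union_of_disjoint, Finset.card_union_of_disjoint]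
  · have h1 : (frobeniusBox n q).card =
        ∑ u ∈ Finset.range q, ∑ v ∈ Finset.range q, ((n + 1) * u + v + 1) := by
      rw [frobeniusBox, Finset.card_image_of_injective, Finset.card_sigma, Finset.sum_product]
      · simp only [Finset.card_range]
      · rintro ⟨⟨u, v⟩, i⟩ ⟨⟨u', v'⟩, i'⟩ h
        simp only [Prod.mk.injEq, Nat.cast_inj] at h
        obtain ⟨h, rfl, h'⟩ := h
        obtain rfl : i = i' := by zify; linarith
        obtain rfl : v = v' := by zify; linarith
        rfl
    have h2 : (frobeniusLeft n q).card = (frobeniusCorner n q).card := by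
      rw [frobeniusLeft, Finset.card_image_of_injective]
      rintro ⟨⟨i, j⟩, u⟩ ⟨⟨i', j'⟩, u'⟩ h
      simp only [Prod.mk.injEq, Nat.cast_inj] at h
      obtain ⟨h, rfl, h'⟩ := h
      obtain rfl : i = i' := by zify; linarith
      obtain rfl : j = j' := by zify; linarith
      rfl
    have h3 : (frobeniusRight n q).card = (n + 1) * (frobeniusCorner n q).card := by
      rw [frobeniusRight, Finset.card_image_of_injOn, Finset.card_product, Finset.card_range]
      rintro ⟨l, ⟨i, j⟩, u⟩ ht ⟨l', ⟨i', j'⟩, u'⟩ ht' h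
      simp only [Finset.coe_product, Set.mem_prod, Finset.mem_coe, mem_frobeniusCorner] at ht ht'
      simp only [Prod.mk.injEq] at h
      obtain ⟨h, hu, h'⟩ := h
      obtain rfl : u = u' := by zify; linarith
      have h4 : i + q * l = i' + q * l' := by zify; linarith
      -- As i, i' < q, dividing by `q` recovers the index of the copy of the corner.
      have h5 : l = l' := by
        have := congrArg (· / q) h4
        simpa [Nat.add_mul_div_left _ _ hq, Nat.div_eq_of_lt ht.2.1,
          Nat.div_eq_of_lt ht'.2.1] using this
      subst h5
      obtain rfl : i = i' := by omega
      obtain rfl : j = j' := by zify; linarith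
      rfl
    rw [h1, h2, h3]
    ring
  · rw [Finset.disjoint_left]
    rintro ⟨a, b, c⟩ h h'
    rw [mem_frobeniusBox] at h
    rw [mem_frobeniusLeft] at h'
    linarith [h.2.2, h'.2.1]
  · rw [Finset.disjoint_left]
    rintro ⟨a, b, c⟩ h h'
    rw [mem_frobeniusRight hq] at h'
    rcases Finset.mem_union.1 h with h | h
    · rw [mem_frobeniusBox] at h
      linarith [h.2.1, h'.2.1]
    · rw [mem_frobeniusLeft] at h
      linarith [h.2.1, h'.2.2.1]

/-! ### Asymptotics and the Hilbert--Kunz multiplicity. -/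

/-- Truncated subtraction gives the positive part of i + j - q: for fixed i only j ≥ q - i can
contribute, with total i (i - 1) / 2, and these add up to the binomial coefficient of q over 3. -/
theorem sum_range_add_tsub (q : ℕ) :
    ((∑ i ∈ Finset.range q, ∑ j ∈ Finset.range q, (i + j - q) : ℕ) : ℝ) =
      q * (q - 1) * (q - 2) / 6 := by
  have h1 : ∀ i m : ℕ, ((∑ j ∈ Finset.range (m + i), (j - m) : ℕ) : ℝ) = i * (i - 1) / 2 := by
    intro i m
    rw [Finset.sum_range_add, Finset.sum_eq_zero, zero_add]
    · simp only [Nat.add_sub_cancel_left]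
      induction i with
      | zero => simp
      | succ i ih => rw [Finset.sum_range_succ, Nat.cast_add, ih]; push_cast; ring
    · intro j hj
      exact Nat.sub_eq_zero_of_le (Finset.mem_range.1 hj).le
  have h2 : ∀ i ∈ Finset.range q,
      ((∑ j ∈ Finset.range q, (i + j - q) : ℕ) : ℝ) = i * (i - 1) / 2 := by
    intro i hi
    rw [← h1 i (q - i), Nat.sub_add_cancel (Finset.mem_range.1 hi).le]
    congr 1
    refine Finset.sum_congr rfl fun j _ => ?_
    have := Finset.mem_range.1 hi
    omega
  rw [Nat.cast_sum, Finset.sum_congr rfl h2]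
  clear h1 h2
  induction q with
  | zero => simp
  | succ q ih => rw [Finset.sum_range_succ, ih]; push_cast; ring

/-- For x ≥ 0, (n + 1)(⌊x / (n + 1)⌋ + 1) lies between x and x + n + 1, and there are at most q²
pairs (i, j). After division by (n + 1) q³ the error is at most 1 / q. -/
theorem card_frobeniusCorner_bounds (n q : ℕ) :
    (q * (q - 1) * (q - 2) / 6 : ℝ) ≤ (n + 1) * (frobeniusCorner n q).card ∧
      ((n + 1) * (frobeniusCorner n q).card : ℝ) ≤
        q * (q - 1) * (q - 2) / 6 + (n + 1) * q ^ 2 := by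
  have hcard : (frobeniusCorner n q).card = ∑ i ∈ Finset.range q, ∑ j ∈ Finset.range q,
      if q ≤ i + j then (i + j - q) / (n + 1) + 1 else 0 := by
    rw [frobeniusCorner, Finset.card_sigma, Finset.sum_product]
    refine Finset.sum_congr rfl fun i _ => Finset.sum_congr rfl fun j _ => ?_
    split_ifs <;> simp
  have h1 : ∑ i ∈ Finset.range q, ∑ j ∈ Finset.range q, (i + j - q) ≤
      (n + 1) * (frobeniusCorner n q).card := by
    rw [hcard, Finset.mul_sum]
    refine Finset.sum_le_sum fun i _ => ?_
    rw [Finset.mul_sum]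
    refine Finset.sum_le_sum fun j _ => ?_
    split_ifs with h
    · exact (Nat.lt_mul_div_succ _ n.succ_pos).le
    · omega
  have h2 : (n + 1) * (frobeniusCorner n q).card ≤
      (∑ i ∈ Finset.range q, ∑ j ∈ Finset.range q, (i + j - q)) + (n + 1) * q ^ 2 := by
    have : (n + 1) * q ^ 2 = ∑ i ∈ Finset.range q, ∑ j ∈ Finset.range q, (n + 1) := by
      simp only [Finset.sum_const, Finset.card_range, smul_eq_mul]
      ring
    rw [hcard, Finset.mul_sum, this, ← Finset.sum_add_distrib]
    refine Finset.sum_le_sum fun i _ => ?_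
    rw [Finset.mul_sum, ← Finset.sum_add_distrib]
    refine Finset.sum_le_sum fun j _ => ?_
    split_ifs with h
    · rw [mul_add, mul_one]
      exact Nat.add_le_add_right (Nat.mul_div_le _ _) _
    · rw [mul_zero]
      exact Nat.zero_le _
  rw [← sum_range_add_tsub]
  exact ⟨by exact_mod_cast h1, by exact_mod_cast h2⟩

theorem sum_range_box (n q : ℕ) :
    ((∑ u ∈ Finset.range q, ∑ v ∈ Finset.range q, ((n + 1) * u + v + 1) : ℕ) : ℝ) =
      q ^ 2 * ((n + 2) * (q - 1) / 2 + 1) := by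
  have hid : ∀ m : ℕ, (∑ u ∈ Finset.range m, (u : ℝ)) = m * (m - 1) / 2 := by
    intro m
    induction m with
    | zero => simp
    | succ m ih => rw [Finset.sum_range_succ, ih]; push_cast; ring
  push_cast
  simp only [Finset.sum_add_distrib, Finset.sum_const, Finset.card_range, ← Finset.mul_sum, hid,
    nsmul_eq_mul]
  ring

theorem tendsto_card_frobeniusCorner (n : ℕ) :
    Tendsto (fun q : ℕ => ((frobeniusCorner n q).card : ℝ) / (q : ℝ) ^ 3) atTop
      (𝓝 (1 / (6 * (n + 1)))) := by
  have h := tendsto_one_div_atTop_nhds_zero_nat (𝕜 := ℝ)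
  have h1 : Tendsto (fun q : ℕ => (1 - 1 / (q : ℝ)) * (1 - 2 * (1 / q)) / (6 * (n + 1))) atTop
      (𝓝 ((1 - 0) * (1 - 2 * 0) / (6 * (n + 1)))) :=
    ((h.const_sub 1).mul ((h.const_mul 2).const_sub 1)).div_const _
  have h2 := h1.add h
  have e : ((1 - 0) * (1 - 2 * 0) / (6 * (n + 1)) : ℝ) = 1 / (6 * (n + 1)) := by ring
  rw [e] at h1
  rw [e, add_zero] at h2
  refine tendsto_of_tendsto_of_tendsto_of_le_of_le' h1 h2 ?_ ?_ <;>
    filter_upwards [eventually_gt_atTop 0] with q hq <;>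
    have hq' : (0 : ℝ) < q := by exact_mod_cast hq
  · rw [le_div_iff₀ (by positivity)]
    have := (card_frobeniusCorner_bounds n q).1
    rw [← div_le_iff₀' (by positivity)] at this
    refine le_trans (le_of_eq ?_) this
    field_simp
  · rw [div_le_iff₀ (by positivity)]
    have := (card_frobeniusCorner_bounds n q).2
    rw [← le_div_iff₀' (by positivity)] at this
    refine this.trans (le_of_eq ?_)
    field_simp

theorem tendsto_card_frobenius_complement (n : ℕ) :
    Tendsto (fun q : ℕ => ((frobeniusBox n q ∪ frobeniusLeft n q ∪ frobeniusRight n q).card : ℝ) /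
      (q : ℝ) ^ 3) atTop (𝓝 ((n + 2) / 2 + (n + 2) / (6 * (n + 1)))) := by
  have h := tendsto_one_div_atTop_nhds_zero_nat (𝕜 := ℝ)
  have h1 : Tendsto (fun q : ℕ => ((n + 2 : ℝ) / 2 * (1 - 1 / q) + 1 / q)) atTop
      (𝓝 ((n + 2) / 2 * (1 - 0) + 0)) := ((h.const_sub 1).const_mul _).add h
  have h2 := h1.add ((tendsto_card_frobeniusCorner n).const_mul (n + 2 : ℝ))
  have e : ((n + 2) / 2 * (1 - 0) + 0 + (n + 2) * (1 / (6 * (n + 1))) : ℝ) =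
      (n + 2) / 2 + (n + 2) / (6 * (n + 1)) := by ring
  rw [e] at h2
  refine h2.congr' ?_
  filter_upwards [eventually_gt_atTop 0] with q hq
  have hq' : (0 : ℝ) < q := by exact_mod_cast hq
  rw [card_frobenius_complement hq, Nat.cast_add, sum_range_box]
  push_cast
  field_simp

/-- In characteristic `p` the `q`-th powers of generators suffice, so the Frobenius power is still
extended from a monomial ideal. -/
theorem frobeniusPower_maximalIdeal {k : Type*} [Field k] (p : ℕ) [Fact p.Prime] [CharP k p]
    {n : ℕ} (A : Type*) [CommRing A] [IsLocalRing A] [Algebra (scrollRing k n) A]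
    [IsLocalization.AtPrime A (scrollIdeal k n)] [Algebra k A] (r : ℕ) :
    frobeniusPower (IsLocalRing.maximalIdeal A) (p ^ r) =
      (Ideal.span (scrollMonomial k '' ((fun w => p ^ r • w) ''
        {w : scrollCone n | w.1.2.2 = 1}))).map (algebraMap _ A) := by
  have : CharP A p := charP_of_injective_algebraMap (algebraMap k A).injective p
  rw [← IsLocalization.AtPrime.map_eq_maximalIdeal (scrollIdeal k n) A, scrollIdeal_eq_span,
    Ideal.map_span, frobeniusPower_span, Ideal.map_span, Set.image_image, Set.image_image,
    Set.image_image, Set.image_image]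
  simp only [scrollMonomial_nsmul, map_pow]

theorem hasHilbertKunzMultiplicity_of_isLocalization (k : Type*) [Field k] (p : ℕ) [Fact p.Prime]
    [CharP k p] (n : ℕ) (A : Type*) [CommRing A] [IsLocalRing A] [Algebra (scrollRing k n) A]
    [IsLocalization.AtPrime A (scrollIdeal k n)] [Algebra k A]
    [IsScalarTower k (scrollRing k n) A] (hd : ringKrullDim A = 3) :
    HasHilbertKunzMultiplicity p (IsLocalRing.maximalIdeal A)
      ((n + 2) / 2 + (n + 2) / (6 * (n + 1))) := by
  have hp := (Fact.out : p.Prime)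
  have hlen : ∀ r : ℕ, Module.length A (A ⧸ frobeniusPower (IsLocalRing.maximalIdeal A) (p ^ r)) =
      (frobeniusBox n (p ^ r) ∪ frobeniusLeft n (p ^ r) ∪ frobeniusRight n (p ^ r)).card := by
    intro r
    have hq : 0 < p ^ r := pow_pos hp.pos r
    rw [frobeniusPower_maximalIdeal (k := k) p (n := n)]
    set I := Ideal.span (scrollMonomial k '' ((fun w => p ^ r • w) ''
      {w : scrollCone n | w.1.2.2 = 1}))
    have hI : ∀ f : scrollRing k n, f ∈ I ↔
        ∀ u ∈ f.1.coeff.support, IsFrobeniusMultiple n (p ^ r) u := by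
      intro f
      rw [mem_span_scrollMonomial_iff]
      refine forall₂_congr fun u _ => ⟨?_, ?_⟩
      · rintro ⟨_, ⟨g, hg, rfl⟩, h⟩
        exact ⟨g, g.2, hg, h⟩
      · rintro ⟨g, hg, hg1, h⟩
        exact ⟨_, ⟨⟨g, hg⟩, hg1, rfl⟩, h⟩
    have hF : ∀ u, u ∈ frobeniusBox n (p ^ r) ∪ frobeniusLeft n (p ^ r) ∪
        frobeniusRight n (p ^ r) ↔ u ∈ scrollCone n ∧ ¬ IsFrobeniusMultiple n (p ^ r) u :=
      fun u => mem_frobenius_complement hq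
    set F := frobeniusBox n (p ^ r) ∪ frobeniusLeft n (p ^ r) ∪ frobeniusRight n (p ^ r)
    -- The complement is finite, so its degrees are at most some B, and the power B + 1 of the
    -- irrelevant ideal lies in `I`.
    obtain ⟨B, hB⟩ := exists_forall_abs_le F
    refine length_quotient_map_of_isLocalization A I (N := B + 1) (fun f hf => ?_) F
      (fun u hu => ((hF u).1 hu).1) fun f => ?_
    · rw [mem_scrollIdeal_pow_iff] at hf
      rw [hI]
      intro u hu
      by_contra hm
      have h1 := (abs_le.1 (hB u ((hF u).2 ⟨mem_scrollRing_iff.1 f.2 u hu, hm⟩)).2.2).2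
      have h2 := hf u hu
      push_cast at h2
      linarith
    · rw [hI]
      constructor
      · intro h u hu
        by_contra hne
        exact ((hF u).1 hu).2 (h u (Finsupp.mem_support_iff.2 hne))
      · intro h u hu
        by_contra hm
        exact Finsupp.mem_support_iff.1 hu (h u ((hF u).2 ⟨mem_scrollRing_iff.1 f.2 u hu, hm⟩))
  refine ⟨fun r => by rw [hlen]; exact ENat.natCast_ne_top _, 3, hd, ?_⟩
  have h := (tendsto_card_frobenius_complement n).comp (tendsto_pow_atTop_atTop_of_one_lt hp.one_lt)
  refine h.congr fun r => ?_
  rw [hlen, ENat.toNat_natCast, Function.comp_apply, Nat.cast_pow]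

theorem mainTheorem10 (k : Type*) [Field k] (p : ℕ) [Fact p.Prime] [CharP k p] (n : ℕ) :
    IsDomain (ScrollLocalRing k n) ∧
    ringKrullDim (ScrollLocalRing k n) = 3 ∧
    IsCohenMacaulayLocal (ScrollLocalRing k n) ∧
    IsFRationalLocal p (ScrollLocalRing k n) ∧
    IsFRational p (ScrollLocalRing k n) ∧
    ∃ e eHK : ℝ,
      HasMultiplicity (A := ScrollLocalRing k n) (IsLocalRing.maximalIdeal _) e ∧
      HasHilbertKunzMultiplicity (A := ScrollLocalRing k n) p (IsLocalRing.maximalIdeal _) eHK ∧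
      e = n + 2 ∧
      eHK = e / 2 + e / (6 * (n + 1)) := by
  have hd := scrollLocalRing_ringKrullDim k n
  exact ⟨IsLocalization.isDomain_localization (Ideal.primeCompl_le_nonZeroDivisors _), hd,
    scrollLocalRing_isCohenMacaulayLocal k n, scrollLocalRing_isFRationalLocal k p n,
    scrollLocalRing_isFRational k p n, n + 2, _, hasMultiplicity_of_isLocalization k n _ hd,
    hasHilbertKunzMultiplicity_of_isLocalization k p n _ hd, rfl, rfl⟩
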